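/- Let $M$ be a connected closed smooth Riemannian manifold, let $\Omega$ be a compact smooth manifold without boundary, equipped with a Riemannian metric, and let $\theta:\Omega\to\Omega$ be a $C^1$ diffeomorphism. Let $f:\Omega\to\mathrm{Diff}^2(M)$, $\omega\mapsto f_\omega$, be continuous for the $C^2$ topology, and let $\phi:M\times\Omega\to M\times\Omega$, $\phi(x,\omega)=(f_\omega(x),\theta\omega)$, be the skew product, with inverse $\phi^{-1}(x,\omega)=((f_{\theta^{-1}\omega})^{-1}(x),\theta^{-1}\omega)$. Give $M\times\Omega$ the product Riemannian metric. Assume: (a) $\phi$ is Anosov on fibers: there are $\lambda_0>0$ and, for every $(x,\omega)\in M\times\Omega$, a splitting $T_xM=E^s(x,\omega)\oplus E^u(x,\omega)$, depending continuously on $(x,\omega)$, with $\dim E^s(x,\omega)>0$ and $\dim E^u(x,\omega)>0$, such that $D_xf_\omega E^{\tau}(x,\omega)=E^{\tau}(\phi(x,\omega))$ for $\tau=s,u$, and $|D_xf_\omega\xi|\ge e^{\lambda_0}|\xi|$ for $\xi\in E^u(x,\omega)$, $|D_xf_\omega\eta|\le e^{-\lambda_0}|\eta|$ for $\eta\in E^s(x,\omega)$.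 (b) $f_\omega(x)$ and $f_\omega^{-1}(x)$ are $C^1$ in $\omega$: for every $x$ the maps $\omega\mapsto f_\omega(x)$ and $\omega\mapsto f_\omega^{-1}(x)$ are $C^1$, and their derivatives with respect to $\omega$ depend continuously on $(x,\omega)$. (c) With $1/0=\infty$ (relevant only if $\dim\Omega=0$), $$\sup_{(x,\omega)\in M\times\Omega}\|D_xf_\omega|_{E^s(x,\omega)}\|<\inf_{\omega\in\Omega}\|D_\omega\theta^{-1}\|^{-1}\quad\text{and}\quad\sup_{\omega\in\Omega}\|D_\omega\theta\|<\inf_{(x,\omega)\in M\times\Omega}\|D_x(f_{\theta^{-1}\omega})^{-1}|_{E^u(x,\omega)}\|^{-1}.$$ Then $\phi$ is partially hyperbolic with stable bundle $E^s\times\{0\}$, unstable bundle $E^u\times\{0\}$ and a center bundle of dimension $\dim\Omega$. That is, $\phi$ is a $C^1$ diffeomorphism of $M\times\Omega$, and there is a family of subspaces $E^c(x,\omega)\subset T_{(x,\omega)}(M\times\Omega)$ of dimension $\dim\Omega$ such that, with $E^1=E^s\times\{0\}$, $E^2=E^c$, $E^3=E^u\times\{0\}$: 1. $T_p(M\times\Omega)=E^1(p)\oplus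 E^2(p)\oplus E^3(p)$ for every $p\in M\times\Omega$, and $E^1,E^2,E^3$ are continuous subbundles of $T(M\times\Omega)$; 2. the splitting is invariant and dominated: $D_p\phi\,E^i(p)=E^i(\phi(p))$ for $i=1,2,3$, and for $i=1,2$ there are $c>0$ and $\lambda\in(0,1)$ such that, for all $p$, all $n\ge0$ and all unit vectors $u\in E^i(p)$, $v\in E^{i+1}(p)$, $$\|D_p\phi^n u\|\le c\lambda^n\|D_p\phi^n v\|$$ (in particular $\|D\phi^n|_{E^i(p)}\|\le c\lambda^n\|D\phi^n|_{E^{i+1}(p)}\|$ whenever $E^{i+1}(p)\neq0$); 3. $E^1$ is uniformly contracted and $E^3$ is uniformly expanded: there are $c>0$ and $\lambda\in(0,1)$ such that $\|D_p\phi^n v\|\le c\lambda^n\|v\|$ for $v\in E^1(p)$ and $\|v\|\le c\lambda^n\|D_p\phi^n v\|$ for $v\in E^3(p)$, for all $p$ and all $n\ge0$. -/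

import Mathlib

open Bundle
open scoped Manifold ContDiff Topology ENNReal

noncomputable section

/-- Continuous subbundles. `V` is a vector bundle over `B` with model fibre `F`, `b : X → B` is a
map, and `S x` is a subspace of the fibre `V (b x)` for every `x : X`. The family `S` is a
continuous vector subbundle of the pull-back of `V` along `b` if locally on `X` it has a frame of
continuous sections. -/
def IsContinuousSubbundle {B X : Type*} [TopologicalSpace B] [TopologicalSpace X]
    (F : Type*) [NormedAddCommGroup F] [NormedSpace ℝ F]
    (V : B → Type*) [∀ y, AddCommGroup (V y)] [∀ y, Module ℝ (V y)]
    [TopologicalSpace (TotalSpace F V)]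
    (b : X → B) (S : ∀ x : X, Submodule ℝ (V (b x))) : Prop :=
  ∀ x₀ : X, ∃ U : Set X, IsOpen U ∧ x₀ ∈ U ∧
    ∃ (k : ℕ) (s : Fin k → ∀ x : X, V (b x)),
      (∀ i, ContinuousOn (fun x => (⟨b x, s i x⟩ : TotalSpace F V)) U) ∧
      ∀ x ∈ U, LinearIndependent ℝ (fun i => s i x) ∧
        Submodule.span ℝ (Set.range fun i => s i x) = S x

section PartiallyHyperbolic

variable {E : Type*} [NormedAddCommGroup E] [NormedSpace ℝ E]
  {H : Type*} [TopologicalSpace H] (I : ModelWithCorners ℝ E H)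
  {N : Type*} [TopologicalSpace N] [ChartedSpace H N] [IsManifold I 1 N]
  [RiemannianBundle (fun p : N => TangentSpace I p)]

/-- The subbundle `S` dominates the subbundle `T` under `φ`: there are `c > 0` and `r ∈ (0, 1)`
with `‖Dφⁿ u‖ ≤ c rⁿ ‖Dφⁿ v‖` for all unit vectors `u ∈ T p`, `v ∈ S p` and all `n ≥ 0`. -/
def IsDominatedBy (φ : N → N) (T S : ∀ p : N, Submodule ℝ (TangentSpace I p)) : Prop :=
  ∃ c : ℝ, 0 < c ∧ ∃ r : ℝ, 0 < r ∧ r < 1 ∧ ∀ (n : ℕ) (p : N), ∀ u ∈ T p, ∀ v ∈ S p,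
    ‖mfderiv I I (φ^[n]) p u‖ * ‖v‖ ≤ c * r ^ n * (‖mfderiv I I (φ^[n]) p v‖ * ‖u‖)

/-- `Dφ` contracts the subbundle `S` uniformly. -/
def IsUniformlyContracted (φ : N → N) (S : ∀ p : N, Submodule ℝ (TangentSpace I p)) : Prop :=
  ∃ c : ℝ, 0 < c ∧ ∃ r : ℝ, 0 < r ∧ r < 1 ∧ ∀ (n : ℕ) (p : N), ∀ v ∈ S p,
    ‖mfderiv I I (φ^[n]) p v‖ ≤ c * r ^ n * ‖v‖

/-- `Dφ` expands the subbundle `S` uniformly. -/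
def IsUniformlyExpanded (φ : N → N) (S : ∀ p : N, Submodule ℝ (TangentSpace I p)) : Prop :=
  ∃ c : ℝ, 0 < c ∧ ∃ r : ℝ, 0 < r ∧ r < 1 ∧ ∀ (n : ℕ) (p : N), ∀ v ∈ S p,
    ‖v‖ ≤ c * r ^ n * ‖mfderiv I I (φ^[n]) p v‖

/-- The bijection `φ` of the Riemannian manifold `N` is a `C¹` diffeomorphism which is partially
hyperbolic (in the narrow sense) with respect to the splitting `TN = E₁ ⊕ E₂ ⊕ E₃`. -/
structure IsPartiallyHyperbolic (φ : N ≃ N)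
    (E₁ E₂ E₃ : ∀ p : N, Submodule ℝ (TangentSpace I p)) : Prop where
  contMDiff : ContMDiff I I 1 φ
  contMDiff_symm : ContMDiff I I 1 φ.symm
  splitting : ∀ p : N, DirectSum.IsInternal ![E₁ p, E₂ p, E₃ p]
  continuous₁ : IsContinuousSubbundle E (fun p : N => TangentSpace I p) id E₁
  continuous₂ : IsContinuousSubbundle E (fun p : N => TangentSpace I p) id E₂
  continuous₃ : IsContinuousSubbundle E (fun p : N => TangentSpace I p) id E₃
  invariant₁ : ∀ p : N, (E₁ p).map (mfderiv I I φ p).toLinearMap = E₁ (φ p)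
  invariant₂ : ∀ p : N, (E₂ p).map (mfderiv I I φ p).toLinearMap = E₂ (φ p)
  invariant₃ : ∀ p : N, (E₃ p).map (mfderiv I I φ p).toLinearMap = E₃ (φ p)
  dominated₁₂ : IsDominatedBy I φ E₁ E₂
  dominated₂₃ : IsDominatedBy I φ E₂ E₃
  contracted : IsUniformlyContracted I φ E₁
  expanded : IsUniformlyExpanded I φ E₃

end PartiallyHyperbolic

section Product

variable {E : Type*} [NormedAddCommGroup E] [NormedSpace ℝ E]
  {H : Type*} [TopologicalSpace H] {I : ModelWithCorners ℝ E H}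
  {M : Type*} [TopologicalSpace M] [ChartedSpace H M]
  {F : Type*} [NormedAddCommGroup F] [NormedSpace ℝ F]
  {G : Type*} [TopologicalSpace G] {J : ModelWithCorners ℝ F G}
  {Ω : Type*} [TopologicalSpace Ω] [ChartedSpace G Ω]

/-- The subspace `S × 0` of `T_(x, ω) (M × Ω) = T_x M × T_ω Ω`. -/
def prodZero (S : ∀ p : M × Ω, Submodule ℝ (TangentSpace I p.1)) (p : M × Ω) :
    Submodule ℝ (TangentSpace (I.prod J) p) :=
  (S p).map (ContinuousLinearMap.inl ℝ (TangentSpace I p.1) (TangentSpace J p.2)).toLinearMap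

variable [RiemannianBundle (fun x : M => TangentSpace I x)]
  [RiemannianBundle (fun t : Ω => TangentSpace J t)]

/-- The product Riemannian metric `⟨(v, w), (v', w')⟩ = ⟨v, v'⟩ + ⟨w, w'⟩` on `M × Ω`. -/
def prodRiemannianMetric :
    RiemannianMetric (fun p : M × Ω => TangentSpace (I.prod J) p) where
  inner p :=
    ((innerSL ℝ (E := TangentSpace I p.1)).bilinearComp
      (ContinuousLinearMap.fst ℝ (TangentSpace I p.1) (TangentSpace J p.2))
      (ContinuousLinearMap.fst ℝ (TangentSpace I p.1) (TangentSpace J p.2)) +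
    (innerSL ℝ (E := TangentSpace J p.2)).bilinearComp
      (ContinuousLinearMap.snd ℝ (TangentSpace I p.1) (TangentSpace J p.2))
      (ContinuousLinearMap.snd ℝ (TangentSpace I p.1) (TangentSpace J p.2)) :
    (TangentSpace I p.1 × TangentSpace J p.2) →L[ℝ]
      (TangentSpace I p.1 × TangentSpace J p.2) →L[ℝ] ℝ)
  symm p v w := by
    let a : TangentSpace I p.1 := v.1
    let a' : TangentSpace I p.1 := w.1
    let b : TangentSpace J p.2 := v.2
    let b' : TangentSpace J p.2 := w.2
    change inner ℝ a a' + inner ℝ b b' = inner ℝ a' a + inner ℝ b' b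
    rw [real_inner_comm, real_inner_comm b]
  pos p v hv := by
    let a : TangentSpace I p.1 := v.1
    let b : TangentSpace J p.2 := v.2
    change 0 < inner ℝ a a + inner ℝ b b
    by_cases h : a = 0
    · have h2 : b ≠ 0 := fun h' => hv (Prod.ext h h')
      exact add_pos_of_nonneg_of_pos real_inner_self_nonneg (real_inner_self_pos.2 h2)
    · exact add_pos_of_pos_of_nonneg (real_inner_self_pos.2 h) real_inner_self_nonneg
  continuousAt p := by
    have : Continuous fun v : TangentSpace I p.1 × TangentSpace J p.2 =>
        inner ℝ v.1 v.1 + inner ℝ v.2 v.2 := by fun_prop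
    exact this.continuousAt
  isVonNBounded p := by
    change Bornology.IsVonNBounded ℝ {v : TangentSpace I p.1 × TangentSpace J p.2 |
      inner ℝ v.1 v.1 + inner ℝ v.2 v.2 < 1}
    refine (NormedSpace.isVonNBounded_ball ℝ
      (TangentSpace I p.1 × TangentSpace J p.2) 1).subset fun v hv => ?_
    simp only [Set.mem_ofPred_eq, real_inner_self_eq_norm_sq] at hv
    rw [mem_ball_zero_iff, Prod.norm_def, max_lt_iff]
    constructor <;> nlinarith [norm_nonneg v.1, norm_nonneg v.2, sq_nonneg ‖v.1‖, sq_nonneg ‖v.2‖]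

instance prodRiemannianBundle :
    RiemannianBundle (fun p : M × Ω => TangentSpace (I.prod J) p) :=
  ⟨prodRiemannianMetric⟩

theorem norm_sq_prod (p : M × Ω) (v : TangentSpace I p.1) (w : TangentSpace J p.2) :
    @norm (TangentSpace (I.prod J) p) _ (v, w) ^ 2 = ‖v‖ ^ 2 + ‖w‖ ^ 2 :=
  (real_inner_self_eq_norm_sq (F := TangentSpace (I.prod J) p) (v, w)).symm.trans
    (congrArg₂ (· + ·) (real_inner_self_eq_norm_sq v) (real_inner_self_eq_norm_sq w))

end Product

section Skew

variable {E : Type*} [NormedAddCommGroup E] [NormedSpace ℝ E]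
  {H : Type*} [TopologicalSpace H] {I : ModelWithCorners ℝ E H}
  {M : Type*} [TopologicalSpace M] [ChartedSpace H M]
  {F : Type*} [NormedAddCommGroup F] [NormedSpace ℝ F]
  {G : Type*} [TopologicalSpace G] {J : ModelWithCorners ℝ F G}
  {Ω : Type*} [TopologicalSpace Ω] [ChartedSpace G Ω]

/-- The skew product `φ (x, ω) = (f_ω x, θ ω)`. -/
def skewProduct (f : Ω → M ≃ₘ^2⟮I, I⟯ M) (θ : Ω ≃ₘ^1⟮J, J⟯ Ω) : M × Ω ≃ M × Ω where
  toFun p := (f p.2 p.1, θ p.2)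
  invFun p := ((f (θ.symm p.2)).symm p.1, θ.symm p.2)
  left_inv p := by simp
  right_inv p := by simp

/-- The map `f : Ω → Diff²(M)` is continuous for the `C²` topology (the compact-open `C²` topology):
the second tangent maps `TTf_ω : TTM → TTM` depend continuously on `ω`, locally uniformly, i.e.
`(ω, ξ) ↦ TTf_ω ξ` is continuous. -/
def IsC2Continuous [IsManifold I ∞ M] (f : Ω → M ≃ₘ^2⟮I, I⟯ M) : Prop :=
  Continuous fun q : Ω × TangentBundle I.tangent (TangentBundle I M) =>
    tangentMap I.tangent I.tangent (tangentMap I I (f q.1)) q.2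

/-- The family `g_ω (x)` is `C¹` in `ω`: every `ω ↦ g_ω (x)` is `C¹`, and its derivative
`D_ω g_ω (x)` is continuous in `(x, ω)`. -/
def IsC1InParameter [IsManifold I 1 M] [IsManifold J 1 Ω] (g : Ω → M → M) : Prop :=
  (∀ x : M, ContMDiff J I 1 fun t => g t x) ∧
    Continuous fun q : M × TangentBundle J Ω => tangentMap J I (fun t => g t q.1) q.2

/-- The skew product `φ` of `f` and `θ` is Anosov on fibers with splitting `T_x M = Es ⊕ Eu` at
`(x, ω)` and constant `lam`. -/
structure IsAnosovOnFibers [IsManifold I 1 M] [RiemannianBundle (fun x : M => TangentSpace I x)]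
    (f : Ω → M ≃ₘ^2⟮I, I⟯ M) (θ : Ω ≃ₘ^1⟮J, J⟯ Ω)
    (Es Eu : ∀ p : M × Ω, Submodule ℝ (TangentSpace I p.1)) (lam : ℝ) : Prop where
  pos : 0 < lam
  splitting : ∀ p, IsCompl (Es p) (Eu p)
  continuous_stable : IsContinuousSubbundle E (fun x : M => TangentSpace I x) Prod.fst Es
  continuous_unstable : IsContinuousSubbundle E (fun x : M => TangentSpace I x) Prod.fst Eu
  finrank_stable_pos : ∀ p, 0 < Module.finrank ℝ (Es p)
  finrank_unstable_pos : ∀ p, 0 < Module.finrank ℝ (Eu p)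
  invariant_stable : ∀ p : M × Ω,
    (Es p).map (mfderiv I I (f p.2) p.1).toLinearMap = Es (skewProduct f θ p)
  invariant_unstable : ∀ p : M × Ω,
    (Eu p).map (mfderiv I I (f p.2) p.1).toLinearMap = Eu (skewProduct f θ p)
  expansion : ∀ p : M × Ω, ∀ v ∈ Eu p, Real.exp lam * ‖v‖ ≤ ‖mfderiv I I (f p.2) p.1 v‖
  contraction : ∀ p : M × Ω, ∀ v ∈ Es p, ‖mfderiv I I (f p.2) p.1 v‖ ≤ Real.exp (-lam) * ‖v‖

end Skew

end

/-! At `p = (x, ω)` the derivative of the skew product is block triangular: `(v, w) ↦ (A v + B w, T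
w)`, where `A = D_x f_ω`, `B` is the derivative of `f_ω x` in `ω`, and `T = D_ω θ`. So `E^s × 0` and
`E^u × 0` are invariant, and the center bundle is sought as the graph of a family `L p : T_ω Ω → T_x
M`. Such a graph is invariant exactly when `A (L p) + B = L (φ p) T`.

Since `A` preserves `E^s` and `E^u`, this equation splits into its two components. The `E^u`
component is a fixed point of `X ↦ A⁻¹ (X T - P_u B)`, which contracts by at most `sup ‖T‖ · sup
‖A⁻¹|E^u‖ < 1`, by the second inequality of (c). The `E^s` component is the same problem for `φ⁻¹`,
where the first inequality of (c) gives the contraction. Both are instances of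
`exists_invariant_graph`, and `exists_invariant_section` adds the two solutions. The iterates are
continuous and converge uniformly on vectors of bounded length, so `L` is continuous.

By compactness `L` is bounded, so on its graph the norm is comparable to the norm of the
`Ω`-component, which evolves under `Dθ` alone. Hence the center bundle has the growth rates of `θ`,
and (c) places these strictly between the rates on `E^s` and on `E^u`: this is domination.

Regularity: jointly continuous partial tangent maps make `φ` of class `C¹`
(`contMDiff_one_of_partial`). Its inverse is `C¹` because `φ` is a homeomorphism with invertible
triangular derivative (`contMDiff_skewProduct_symm`). -/

noncomputable section

open Filter

/-! ### Continuous sections of vector bundles along a map. -/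

section VectorBundleSections

variable {B : Type*} [TopologicalSpace B] {F : Type*} [NormedAddCommGroup F] [NormedSpace ℝ F]
  {V : B → Type*} [TopologicalSpace (TotalSpace F V)] [∀ y, AddCommGroup (V y)]
  [∀ y, Module ℝ (V y)] [∀ y, TopologicalSpace (V y)] [FiberBundle F V] [VectorBundle ℝ F V]
  {X : Type*} [TopologicalSpace X] {b : X → B} {v w : ∀ x, V (b x)} {x₀ : X}

/-- Continuity of a section along `b`, read in the trivialization at a point. -/
theorem continuousAt_section_iff :
    ContinuousAt (fun x => (⟨b x, v x⟩ : TotalSpace F V)) x₀ ↔ ContinuousAt b x₀ ∧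
      ContinuousAt (fun x =>
        (trivializationAt F V (b x₀)).continuousLinearMapAt ℝ (b x) (v x)) x₀ := by
  rw [FiberBundle.continuousAt_totalSpace]
  refine and_congr_right fun hb => continuousAt_congr ?_
  filter_upwards [hb.eventually ((trivializationAt F V (b x₀)).open_baseSet.mem_nhds
    (FiberBundle.mem_baseSet_trivializationAt' (b x₀)))] with x hx
  rw [Trivialization.continuousLinearMapAt_apply, Trivialization.linearMapAt_apply]
  exact (if_pos hx).symm

theorem ContinuousAt.add_section (hv : ContinuousAt (fun x => (⟨b x, v x⟩ : TotalSpace F V)) x₀)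
    (hw : ContinuousAt (fun x => (⟨b x, w x⟩ : TotalSpace F V)) x₀) :
    ContinuousAt (fun x => (⟨b x, v x + w x⟩ : TotalSpace F V)) x₀ := by
  rw [continuousAt_section_iff] at *
  refine ⟨hv.1, ?_⟩
  simp only [map_add]
  exact hv.2.add hw.2

theorem ContinuousAt.sub_section (hv : ContinuousAt (fun x => (⟨b x, v x⟩ : TotalSpace F V)) x₀)
    (hw : ContinuousAt (fun x => (⟨b x, w x⟩ : TotalSpace F V)) x₀) :
    ContinuousAt (fun x => (⟨b x, v x - w x⟩ : TotalSpace F V)) x₀ := by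
  rw [continuousAt_section_iff] at *
  refine ⟨hv.1, ?_⟩
  simp only [map_sub]
  exact hv.2.sub hw.2

theorem ContinuousAt.zero_section (hb : ContinuousAt b x₀) :
    ContinuousAt (fun x => (⟨b x, 0⟩ : TotalSpace F V)) x₀ := by
  rw [continuousAt_section_iff]
  refine ⟨hb, ?_⟩
  simp only [map_zero]
  exact continuousAt_const

/-- The projection onto the second summand of a splitting into continuous subbundles maps
continuous sections to continuous sections. -/
theorem ContinuousAt.proj_section [FiniteDimensional ℝ F] {Y : Type*} [TopologicalSpace Y]
    {S U : ∀ x, Submodule ℝ (V (b x))} (hb : Continuous b)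
    (hS : IsContinuousSubbundle F V b S) (hU : IsContinuousSubbundle F V b U)
    (hSU : ∀ x, IsCompl (S x) (U x)) {c : Y → X} {y₀ : Y} (hc : ContinuousAt c y₀)
    {v : ∀ y, V (b (c y))} (hv : ContinuousAt (fun y => (⟨b (c y), v y⟩ : TotalSpace F V)) y₀) :
    ContinuousAt (fun y => (⟨b (c y), ((U (c y)).projection (S (c y)) (hSU (c y)).symm) (v y)⟩ :
      TotalSpace F V)) y₀ := by
  obtain ⟨N₁, hN₁, hx₁, k, s, hs, hsN⟩ := hS (c y₀)
  obtain ⟨N₂, hN₂, hx₂, l, u, hu, huN⟩ := hU (c y₀)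
  rw [continuousAt_section_iff] at *
  refine ⟨hv.1, ?_⟩
  set e := trivializationAt F V (b (c y₀)) with he
  have hsc : ∀ i, ContinuousAt (fun x => e.continuousLinearMapAt ℝ (b x) (s i x)) (c y₀) :=
    fun i => (continuousAt_section_iff.1 ((hs i).continuousAt (hN₁.mem_nhds hx₁))).2
  have huc : ∀ i, ContinuousAt (fun x => e.continuousLinearMapAt ℝ (b x) (u i x)) (c y₀) :=
    fun i => (continuousAt_section_iff.1 ((hu i).continuousAt (hN₂.mem_nhds hx₂))).2
  -- The two frames together give coordinates on the fibre, read in a fixed trivialization. In them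
  -- the projection is `Φ ∘ pr ∘ Φ⁻¹`, and its continuity reduces to continuity of operator
  -- inversion at an invertible operator.
  let Φ : X → ((Fin k → ℝ) × (Fin l → ℝ)) →L[ℝ] F := fun x =>
    ∑ i, ((ContinuousLinearMap.proj i).comp (ContinuousLinearMap.fst ℝ _ _)).smulRight
      (e.continuousLinearMapAt ℝ (b x) (s i x)) +
    ∑ i, ((ContinuousLinearMap.proj i).comp (ContinuousLinearMap.snd ℝ _ _)).smulRight
      (e.continuousLinearMapAt ℝ (b x) (u i x))
  have hΦ : ∀ x a d, Φ x (a, d) = e.continuousLinearMapAt ℝ (b x)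
      (∑ i, a i • s i x + ∑ i, d i • u i x) := by
    intro x a d
    simp [Φ, map_sum]
  have hΦc : ContinuousAt Φ (c y₀) := by
    have key : ∀ g : ((Fin k → ℝ) × (Fin l → ℝ)) →L[ℝ] ℝ,
        Continuous fun z : F => g.smulRight z := fun g =>
      (ContinuousLinearMap.smulRightL ℝ ((Fin k → ℝ) × (Fin l → ℝ)) F g).continuous
    refine ContinuousAt.add ?_ ?_
    · exact tendsto_finsetSum _ fun i _ => (key _).continuousAt.comp (hsc i)
    · exact tendsto_finsetSum _ fun i _ => (key _).continuousAt.comp (huc i)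
  let pr : ((Fin k → ℝ) × (Fin l → ℝ)) →L[ℝ] ((Fin k → ℝ) × (Fin l → ℝ)) :=
    (ContinuousLinearMap.inr ℝ _ _).comp (ContinuousLinearMap.snd ℝ _ _)
  have hinv : ∀ x, x ∈ N₁ → x ∈ N₂ → b x ∈ e.baseSet → (Φ x).IsInvertible := by
    intro x h₁ h₂ hxe
    have hinj : Function.Injective (e.continuousLinearMapAt ℝ (b x)) := by
      have := (e.continuousLinearEquivAt ℝ (b x) hxe).injective
      rwa [← ContinuousLinearEquiv.coe_coe, Trivialization.coe_continuousLinearEquivAt_eq'] at this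
    have hsurj : Function.Surjective (e.continuousLinearMapAt ℝ (b x)) := by
      have := (e.continuousLinearEquivAt ℝ (b x) hxe).surjective
      rwa [← ContinuousLinearEquiv.coe_coe, Trivialization.coe_continuousLinearEquivAt_eq'] at this
    have memS : ∀ a : Fin k → ℝ, ∑ i, a i • s i x ∈ S x := fun a => by
      rw [← (hsN x h₁).2]
      exact Submodule.sum_mem _ fun i _ => Submodule.smul_mem _ _ (Submodule.subset_span ⟨i, rfl⟩)
    have memU : ∀ a : Fin l → ℝ, ∑ i, a i • u i x ∈ U x := fun a => by
      rw [← (huN x h₂).2]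
      exact Submodule.sum_mem _ fun i _ => Submodule.smul_mem _ _ (Submodule.subset_span ⟨i, rfl⟩)
    have hbij : Function.Bijective (Φ x) := by
      constructor
      · rw [injective_iff_map_eq_zero]
        rintro ⟨a, d⟩ h
        rw [hΦ, ← map_zero (e.continuousLinearMapAt ℝ (b x))] at h
        have h0 := hinj h
        have h1 : ∑ i, a i • s i x = 0 := by
          have : ∑ i, a i • s i x ∈ U x := by
            rw [eq_neg_of_add_eq_zero_left h0]
            exact (U x).neg_mem (memU d)
          exact Submodule.disjoint_def.1 (hSU x).disjoint _ (memS a) this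
        have h2 : ∑ i, d i • u i x = 0 := by rwa [h1, zero_add] at h0
        ext i
        · exact Fintype.linearIndependent_iff.1 (hsN x h₁).1 a h1 i
        · exact Fintype.linearIndependent_iff.1 (huN x h₂).1 d h2 i
      · intro z
        obtain ⟨z', rfl⟩ := hsurj z
        obtain ⟨p, hp, q, hq, rfl⟩ := Submodule.mem_sup.1
          ((hSU x).sup_eq_top ▸ Submodule.mem_top : z' ∈ S x ⊔ U x)
        rw [← (hsN x h₁).2, Submodule.mem_span_range_iff_exists_fun] at hp
        rw [← (huN x h₂).2, Submodule.mem_span_range_iff_exists_fun] at hq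
        obtain ⟨a, rfl⟩ := hp
        obtain ⟨d, rfl⟩ := hq
        exact ⟨(a, d), hΦ x a d⟩
    exact ⟨ContinuousLinearEquiv.ofBijective (Φ x) (LinearMap.ker_eq_bot.2 hbij.1)
      (LinearMap.range_eq_top.2 hbij.2), by ext <;> rfl⟩
  have hev : ∀ᶠ x in 𝓝 (c y₀), x ∈ N₁ ∧ x ∈ N₂ ∧ b x ∈ e.baseSet :=
    (hN₁.eventually_mem hx₁).and ((hN₂.eventually_mem hx₂).and (hb.continuousAt.eventually
      (e.open_baseSet.mem_nhds (FiberBundle.mem_baseSet_trivializationAt' _))))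
  have hx₀ := hev.self_of_nhds
  have hinvc : ContinuousAt (fun x => (Φ x).inverse) (c y₀) := by
    obtain ⟨Φ₀, h₀⟩ := hinv _ hx₀.1 hx₀.2.1 hx₀.2.2
    have := (contDiffAt_map_inverse (𝕜 := ℝ) (n := 0) Φ₀).continuousAt
    rw [h₀] at this
    exact ContinuousAt.comp this hΦc
  have hmain : ContinuousAt (fun y => Φ (c y) (pr ((Φ (c y)).inverse
      (e.continuousLinearMapAt ℝ (b (c y)) (v y))))) y₀ :=
    (hΦc.comp hc).clm_apply (pr.continuous.continuousAt.comp
      ((ContinuousAt.comp hinvc hc).clm_apply hv.2))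
  refine hmain.congr ?_
  filter_upwards [hc.eventually hev] with y ⟨h₁, h₂, h₃⟩
  have hi := hinv _ h₁ h₂ h₃
  obtain ⟨a, d, had⟩ : ∃ (a : Fin k → ℝ) (d : Fin l → ℝ), v y = ∑ i, a i • s i (c y) + ∑ i, d i • u i (c y) := by
    obtain ⟨p, hp, q, hq, h⟩ := Submodule.mem_sup.1
      ((hSU (c y)).sup_eq_top ▸ Submodule.mem_top : v y ∈ S (c y) ⊔ U (c y))
    rw [← (hsN _ h₁).2, Submodule.mem_span_range_iff_exists_fun] at hp
    rw [← (huN _ h₂).2, Submodule.mem_span_range_iff_exists_fun] at hq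
    obtain ⟨a, rfl⟩ := hp
    obtain ⟨d, rfl⟩ := hq
    exact ⟨a, d, h.symm⟩
  have memS : ∑ i, a i • s i (c y) ∈ S (c y) := by
    rw [← (hsN _ h₁).2]
    exact Submodule.sum_mem _ fun i _ => Submodule.smul_mem _ _ (Submodule.subset_span ⟨i, rfl⟩)
  have memU : ∑ i, d i • u i (c y) ∈ U (c y) := by
    rw [← (huN _ h₂).2]
    exact Submodule.sum_mem _ fun i _ => Submodule.smul_mem _ _ (Submodule.subset_span ⟨i, rfl⟩)
  have h1 : (Φ (c y)).inverse (e.continuousLinearMapAt ℝ (b (c y)) (v y)) = (a, d) := by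
    rw [had, ← hΦ]
    obtain ⟨Ψ, hΨ⟩ := hi
    rw [← hΨ, ContinuousLinearMap.inverse_equiv]
    exact Ψ.symm_apply_apply _
  rw [h1]
  change Φ (c y) (0, d) = _
  rw [hΦ, had, map_add, map_add, (Submodule.projection_apply_eq_zero_iff _).2 memS, Submodule.projection_apply_of_mem_left _ memU]
  simp [e]

end VectorBundleSections

/-! ### Norms, uniform limits and bounds in Riemannian bundles. -/

section RiemannianSections

variable {B : Type*} [TopologicalSpace B] {F : Type*} [NormedAddCommGroup F] [NormedSpace ℝ F]
  {V : B → Type*} [TopologicalSpace (TotalSpace F V)] [∀ y, NormedAddCommGroup (V y)]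
  [∀ y, InnerProductSpace ℝ (V y)] [FiberBundle F V] [VectorBundle ℝ F V]
  [IsContinuousRiemannianBundle F V]
  {X : Type*} [TopologicalSpace X] {b : X → B} {x₀ : X}

theorem ContinuousAt.norm_bundle {v : ∀ x, V (b x)}
    (hv : ContinuousAt (fun x => (⟨b x, v x⟩ : TotalSpace F V)) x₀) :
    ContinuousAt (fun x => ‖v x‖) x₀ := by
  have h := (hv.inner_bundle hv).sqrt
  simpa only [real_inner_self_eq_norm_sq, Real.sqrt_sq (norm_nonneg _)] using h

theorem continuous_norm_totalSpace : Continuous fun ξ : TotalSpace F V => ‖ξ.2‖ :=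
  continuous_iff_continuousAt.2 fun _ => ContinuousAt.norm_bundle (b := fun ξ : TotalSpace F V => ξ.1)
    continuousAt_id

/-- A section which is locally uniformly approximated by continuous sections is continuous. -/
theorem ContinuousAt.section_of_approx {v : ∀ x, V (b x)} (hb : ContinuousAt b x₀)
    (h : ∀ ε > 0, ∃ w : ∀ x, V (b x),
      ContinuousAt (fun x => (⟨b x, w x⟩ : TotalSpace F V)) x₀ ∧ ∀ᶠ x in 𝓝 x₀, ‖v x - w x‖ ≤ ε) :
    ContinuousAt (fun x => (⟨b x, v x⟩ : TotalSpace F V)) x₀ := by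
  rw [continuousAt_section_iff]
  refine ⟨hb, continuousAt_of_locally_uniform_approx_of_continuousAt fun s hs => ?_⟩
  obtain ⟨δ, hδ, hδs⟩ := Metric.mem_uniformity_dist.1 hs
  obtain ⟨C, hC, hCe⟩ := eventually_norm_trivializationAt_lt F V (b x₀)
  -- The trivialization has operator norm below `C` near the base point, so an error `δ / (2 * C)`
  -- in the fibre becomes at most `δ / 2` in coordinates.
  obtain ⟨w, hw, hvw⟩ := h (δ / (2 * C)) (by positivity)
  refine ⟨_, hvw.and (hb.eventually hCe), _, (continuousAt_section_iff.1 hw).2, ?_⟩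
  rintro x ⟨h₁, h₂⟩
  apply hδs
  rw [dist_eq_norm, ← map_sub]
  calc _ ≤ C * (δ / (2 * C)) := (ContinuousLinearMap.le_opNorm _ _).trans (by gcongr)
    _ = δ / 2 := by field_simp
    _ < δ := half_lt_self hδ

variable {B' : Type*} [TopologicalSpace B'] {F' : Type*} [NormedAddCommGroup F'] [NormedSpace ℝ F']
  {V' : B' → Type*} [TopologicalSpace (TotalSpace F' V')] [∀ y, NormedAddCommGroup (V' y)]
  [∀ y, InnerProductSpace ℝ (V' y)] [FiberBundle F' V'] [VectorBundle ℝ F' V']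
  [IsContinuousRiemannianBundle F' V']

/-- A continuous vector bundle morphism over a compact base is bounded. -/
theorem exists_opNorm_le_of_continuous [CompactSpace B] [CompactSpace B']
    (L : ∀ p : B × B', V' p.2 →L[ℝ] V p.1)
    (hL : Continuous fun q : B × TotalSpace F' V' => (⟨q.1, L (q.1, q.2.1) q.2.2⟩ : TotalSpace F V)) :
    ∃ K, ∀ p, ‖L p‖ ≤ K := by
  have hloc : ∀ p₀ : B × B', ∃ K, ∀ᶠ p in 𝓝 p₀, ‖L p‖ ≤ K := by
    rintro ⟨x₀, y₀⟩
    set e := trivializationAt F' V' y₀ with he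
    have hy₀ : y₀ ∈ e.baseSet := FiberBundle.mem_baseSet_trivializationAt' y₀
    have hsymm : ContinuousAt (fun z : B' × F' => (⟨z.1, e.symm z.1 z.2⟩ : TotalSpace F' V'))
        (y₀, 0) := (e.continuousOn_symm).continuousAt
          ((e.open_baseSet.prod isOpen_univ).mem_nhds ⟨hy₀, trivial⟩)
    have hg : ContinuousAt (fun z : B × B' × F' => ‖L (z.1, z.2.1) (e.symm z.2.1 z.2.2)‖)
        (x₀, y₀, 0) := by
      have h1 : ContinuousAt (fun z : B × B' × F' =>
          (z.1, (⟨z.2.1, e.symm z.2.1 z.2.2⟩ : TotalSpace F' V'))) (x₀, y₀, 0) :=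
        continuousAt_fst.prodMk (ContinuousAt.comp (f := Prod.snd) (x := (x₀, y₀, (0 : F'))) hsymm
          continuousAt_snd)
      exact ((continuous_norm_totalSpace.comp hL).continuousAt).comp h1
    -- Continuity at the zero vector alone gives a bound by `1` on a ball of fixed radius in all
    -- nearby fibres; linearity turns this into an operator norm bound.
    have hlt : ∀ᶠ z in 𝓝 (x₀, y₀, (0 : F')), ‖L (z.1, z.2.1) (e.symm z.2.1 z.2.2)‖ < 1 := by
      refine hg.eventually_lt continuousAt_const ?_
      have : e.symm y₀ 0 = 0 := (e.symmₗ_apply (R := ℝ) hy₀ 0).symm.trans (map_zero (e.symmₗ ℝ y₀))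
      simp [this]
    replace hlt := ((Homeomorph.prodAssoc B B' F').continuous.continuousAt
      (x := ((x₀, y₀), (0 : F')))).eventually hlt
    rw [nhds_prod_eq] at hlt
    obtain ⟨P, hP, Q, hQ, hPQ⟩ := Filter.eventually_prod_iff.1 hlt
    obtain ⟨δ, hδ, hδQ⟩ := Metric.eventually_nhds_iff.1 hQ
    obtain ⟨C, hC, hCe⟩ := eventually_norm_trivializationAt_lt F' V' y₀
    refine ⟨2 * C / δ, ?_⟩
    filter_upwards [hP, continuousAt_snd.eventually hCe,
      continuousAt_snd.eventually (e.open_baseSet.eventually_mem hy₀)] with p h₁ h₂ h₃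
    refine ContinuousLinearMap.opNorm_le_bound _ (by positivity) fun ξ => ?_
    rcases eq_or_ne ξ 0 with rfl | hξ
    · simp
    have hξ' : 0 < ‖ξ‖ := norm_pos_iff.2 hξ
    -- Scaling that brings the coordinates of `t • ξ` to norm at most `δ / 2`, inside the ball where
    -- the bound `1` holds.
    set t : ℝ := δ / (2 * C * ‖ξ‖) with ht
    have ht0 : 0 < t := by positivity
    have h4 : ‖e.continuousLinearMapAt ℝ p.2 (t • ξ)‖ < δ := by
      refine (ContinuousLinearMap.le_opNorm _ _).trans_lt ?_
      rw [norm_smul, Real.norm_of_nonneg ht0.le]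
      calc _ ≤ C * (t * ‖ξ‖) := by gcongr
        _ = δ / 2 := by rw [ht]; field_simp
        _ < δ := half_lt_self hδ
    have h5 : ‖L p (e.symm p.2 (e.continuousLinearMapAt ℝ p.2 (t • ξ)))‖ < 1 :=
      hPQ h₁ (hδQ (by rwa [dist_zero_right]))
    have h6 : e.symm p.2 (e.continuousLinearMapAt ℝ p.2 (t • ξ)) = t • ξ :=
      (e.symmₗ_apply (R := ℝ) h₃ _).symm.trans (e.symmₗ_linearMapAt h₃ _)
    rw [h6, map_smul, norm_smul, Real.norm_of_nonneg ht0.le, ht] at h5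
    rw [div_mul_eq_mul_div, div_lt_one (by positivity)] at h5
    rw [div_mul_eq_mul_div, le_div_iff₀ hδ, mul_comm]
    exact h5.le
  choose K hK using hloc
  obtain ⟨t, ht⟩ := CompactSpace.elim_nhds_subcover (fun p => {q | ‖L q‖ ≤ K p}) hK
  refine ⟨∑ p ∈ t, |K p|, fun p => ?_⟩
  obtain ⟨q, hq, hpq⟩ := Set.mem_iUnion₂.1 (ht.symm ▸ Set.mem_univ p :
    p ∈ ⋃ x ∈ t, {q | ‖L q‖ ≤ K x})
  exact (show ‖L p‖ ≤ K q from hpq).trans ((le_abs_self _).trans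
    (Finset.single_le_sum (f := fun p => |K p|) (fun _ _ => abs_nonneg _) hq))

end RiemannianSections

/-! ### Joint `C¹` regularity from partial derivatives. -/

section JointRegularity

variable {E : Type*} [NormedAddCommGroup E] [NormedSpace ℝ E]
  {M : Type*} [TopologicalSpace M] [ChartedSpace E M]
  {F : Type*} [NormedAddCommGroup F] [NormedSpace ℝ F]
  {Ω : Type*} [TopologicalSpace Ω] [ChartedSpace F Ω]
  {E' : Type*} [NormedAddCommGroup E'] [NormedSpace ℝ E']
  {N : Type*} [TopologicalSpace N] [ChartedSpace E' N]

theorem ContMDiffOn.continuousOn_tangentMap [IsManifold 𝓘(ℝ, E) 1 M] [IsManifold 𝓘(ℝ, E') 1 N]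
    {f : M → N} {s : Set M} (hf : ContMDiffOn 𝓘(ℝ, E) 𝓘(ℝ, E') 1 f s) (hs : IsOpen s) :
    ContinuousOn (tangentMap 𝓘(ℝ, E) 𝓘(ℝ, E') f) (TotalSpace.proj ⁻¹' s) :=
  (hf.continuousOn_tangentMapWithin le_rfl hs.uniqueMDiffOn).congr fun _ hp =>
    (tangentMapWithin_eq_tangentMap (hs.uniqueMDiffOn _ hp)
      ((hf.mdifferentiableOn one_ne_zero _ hp).mdifferentiableAt (hs.mem_nhds hp))).symm

/-- A family of differentiable maps with jointly continuous tangent maps, read in charts. -/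
theorem hasFDerivAt_and_continuousAt_fderiv_chart [FiniteDimensional ℝ E]
    [IsManifold 𝓘(ℝ, E) 1 M] [IsManifold 𝓘(ℝ, E') 1 N] {A : Type*} [TopologicalSpace A]
    {g : A → M → N} (hg : ∀ a, MDifferentiable 𝓘(ℝ, E) 𝓘(ℝ, E') (g a))
    (hc : Continuous fun q : A × TangentBundle 𝓘(ℝ, E) M => tangentMap 𝓘(ℝ, E) 𝓘(ℝ, E') (g q.1) q.2)
    (x₀ : M) (n₀ : N) {a : A} {y : E} (hy : y ∈ (extChartAt 𝓘(ℝ, E) x₀).target)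
    (hn : g a ((extChartAt 𝓘(ℝ, E) x₀).symm y) ∈ (extChartAt 𝓘(ℝ, E') n₀).source) :
    DifferentiableAt ℝ (fun z => extChartAt 𝓘(ℝ, E') n₀ (g a ((extChartAt 𝓘(ℝ, E) x₀).symm z))) y ∧
    ContinuousAt (fun q : A × E => fderiv ℝ
      (fun z => extChartAt 𝓘(ℝ, E') n₀ (g q.1 ((extChartAt 𝓘(ℝ, E) x₀).symm z))) q.2) (a, y) := by
  set e := extChartAt 𝓘(ℝ, E) x₀ with he
  set d := extChartAt 𝓘(ℝ, E') n₀ with hd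
  have heo : IsOpen e.target := isOpen_extChartAt_target x₀
  have hdo : IsOpen d.source := isOpen_extChartAt_source n₀
  have hes : ContMDiffOn 𝓘(ℝ, E) 𝓘(ℝ, E) 1 e.symm e.target := contMDiffOn_extChartAt_symm x₀
  have hds : ContMDiffOn 𝓘(ℝ, E') 𝓘(ℝ, E') 1 d d.source := by
    rw [hd, extChartAt_source]
    exact contMDiffOn_extChartAt
  have hed : ∀ z ∈ e.target, MDifferentiableAt 𝓘(ℝ, E) 𝓘(ℝ, E) e.symm z := fun z hz =>
    (hes.mdifferentiableOn one_ne_zero z hz).mdifferentiableAt (heo.mem_nhds hz)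
  have hdd : ∀ z ∈ d.source, MDifferentiableAt 𝓘(ℝ, E') 𝓘(ℝ, E') d z := fun z hz =>
    (hds.mdifferentiableOn one_ne_zero z hz).mdifferentiableAt (hdo.mem_nhds hz)
  have hdiff : ∀ (a : A) (z : E), z ∈ e.target → g a (e.symm z) ∈ d.source →
      MDifferentiableAt 𝓘(ℝ, E) 𝓘(ℝ, E') (fun z => d (g a (e.symm z))) z := fun a z hz hz' =>
    (hdd _ hz').comp z ((hg a _).comp z (hed z hz))
  refine ⟨(hdiff a y hy hn).differentiableAt, ?_⟩
  -- As `E` is finite-dimensional, operator-norm continuity can be tested on one vector `v` at a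
  -- time. The constant field `v` is then carried through the tangent maps of `e.symm`, `g` and `d`.
  rw [continuousAt_clm_apply]
  intro v
  have c1 : ContinuousAt (fun q : A × E => (q.1, tangentMap 𝓘(ℝ, E) 𝓘(ℝ, E) e.symm
      (⟨q.2, v⟩ : TangentBundle 𝓘(ℝ, E) E))) (a, y) := by
    refine continuousAt_fst.prodMk ?_
    have h1 : Continuous fun z : E => (⟨z, v⟩ : TangentBundle 𝓘(ℝ, E) E) :=
      (tangentBundleModelSpaceHomeomorph 𝓘(ℝ, E)).symm.continuous.comp
        (Continuous.prodMk_left v : Continuous fun z : E => (z, v))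
    have h2 := (hes.continuousOn_tangentMap heo).continuousAt
      (x := (⟨y, v⟩ : TangentBundle 𝓘(ℝ, E) E))
      ((heo.preimage (FiberBundle.continuous_proj _ _)).mem_nhds hy)
    exact ContinuousAt.comp (x := (a, y)) (f := fun q : A × E => (⟨q.2, v⟩ : TangentBundle 𝓘(ℝ, E) E)) h2
      (h1.comp continuous_snd).continuousAt
  have c2 := hc.continuousAt.comp c1
  have c3 := (hds.continuousOn_tangentMap hdo).continuousAt
    (x := tangentMap 𝓘(ℝ, E) 𝓘(ℝ, E') (g a) (tangentMap 𝓘(ℝ, E) 𝓘(ℝ, E) e.symm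
      (⟨y, v⟩ : TangentBundle 𝓘(ℝ, E) E)))
    ((hdo.preimage (FiberBundle.continuous_proj _ _)).mem_nhds hn)
  have c4 := ContinuousAt.comp (x := (a, y)) c3 c2
  have c5 := (continuous_snd.comp
    (tangentBundleModelSpaceHomeomorph 𝓘(ℝ, E')).continuous).continuousAt.comp c4
  refine c5.congr ?_
  have hev : ∀ᶠ q : A × E in 𝓝 (a, y), q.2 ∈ e.target ∧ g q.1 (e.symm q.2) ∈ d.source := by
    refine (continuousAt_snd.eventually (heo.eventually_mem hy)).and ?_
    have := (FiberBundle.continuous_proj E' (TangentSpace 𝓘(ℝ, E') (M := N))).continuousAt.comp c2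
    exact this.eventually (hdo.eventually_mem hn)
  filter_upwards [hev] with q hq
  rw [← mfderiv_eq_fderiv]
  have e1 := mfderiv_comp q.2 (hdd _ hq.2) ((hg q.1 _).comp q.2 (hed _ hq.1))
  have e2 := mfderiv_comp q.2 (hg q.1 _) (hed _ hq.1)
  have e3 : (fun z => d (g q.1 (e.symm z))) = d ∘ (g q.1 ∘ e.symm) := rfl
  rw [e3, e1, e2]
  rfl

/-- A map on a product of manifolds is `C¹` if its partial tangent maps are jointly continuous. -/
theorem contMDiff_one_of_partial [FiniteDimensional ℝ E] [FiniteDimensional ℝ F]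
    [IsManifold 𝓘(ℝ, E) 1 M] [IsManifold 𝓘(ℝ, F) 1 Ω] [IsManifold 𝓘(ℝ, E') 1 N] {g : M × Ω → N}
    (h₁ : ∀ t, MDifferentiable 𝓘(ℝ, E) 𝓘(ℝ, E') fun x => g (x, t))
    (h₂ : ∀ x, MDifferentiable 𝓘(ℝ, F) 𝓘(ℝ, E') fun t => g (x, t))
    (c₁ : Continuous fun q : Ω × TangentBundle 𝓘(ℝ, E) M =>
      tangentMap 𝓘(ℝ, E) 𝓘(ℝ, E') (fun x => g (x, q.1)) q.2)
    (c₂ : Continuous fun q : M × TangentBundle 𝓘(ℝ, F) Ω =>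
      tangentMap 𝓘(ℝ, F) 𝓘(ℝ, E') (fun t => g (q.1, t)) q.2) :
    ContMDiff (𝓘(ℝ, E).prod 𝓘(ℝ, F)) 𝓘(ℝ, E') 1 g := by
  -- Base points of the tangent map on the zero section are the values of `g`, so continuity of `c₂`
  -- already contains that of `g`.
  have hgc : Continuous g := by
    have h := (FiberBundle.continuous_proj E' (TangentSpace 𝓘(ℝ, E') (M := N))).comp
      (c₂.comp ((continuous_id (X := M)).prodMap
        (Bundle.Trivialization.continuous_zeroSection (B := Ω) (F := F) ℝ (E := TangentSpace 𝓘(ℝ, F)))))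
    exact h
  rintro ⟨x₀, t₀⟩
  rw [contMDiffAt_iff]
  refine ⟨hgc.continuousAt, ContDiffAt.contDiffWithinAt ?_⟩
  rw [extChartAt_prod]
  set e := extChartAt 𝓘(ℝ, E) x₀ with he
  set e' := extChartAt 𝓘(ℝ, F) t₀ with he'
  set d := extChartAt 𝓘(ℝ, E') (g (x₀, t₀)) with hd
  have heo : IsOpen e.target := isOpen_extChartAt_target x₀
  have heo' : IsOpen e'.target := isOpen_extChartAt_target t₀
  have hdo : IsOpen d.source := isOpen_extChartAt_source _
  let W : Set (E × F) := {q | (q.1 ∈ e.target ∧ q.2 ∈ e'.target) ∧ g (e.symm q.1, e'.symm q.2) ∈ d.source}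
  have hcs : ∀ q : E × F, q.1 ∈ e.target → q.2 ∈ e'.target →
      ContinuousAt (fun q : E × F => (e.symm q.1, e'.symm q.2)) q := fun q h1 h2 =>
    (((continuousOn_extChartAt_symm x₀).continuousAt (heo.mem_nhds h1)).comp continuousAt_fst).prodMk
      (((continuousOn_extChartAt_symm t₀).continuousAt (heo'.mem_nhds h2)).comp continuousAt_snd)
  have hW : IsOpen W := by
    rw [isOpen_iff_mem_nhds]
    rintro q ⟨⟨h1, h2⟩, h3⟩
    filter_upwards [continuousAt_fst.eventually (heo.eventually_mem h1),
      continuousAt_snd.eventually (heo'.eventually_mem h2),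
      (hgc.continuousAt.comp (hcs q h1 h2)).eventually (hdo.eventually_mem h3)] with r r1 r2 r3
    exact ⟨⟨r1, r2⟩, r3⟩
  have hmem : (e x₀, e' t₀) ∈ W :=
    ⟨⟨mem_extChartAt_target x₀, mem_extChartAt_target t₀⟩, by
      simp only [he, he', extChartAt_to_inv]; exact mem_extChartAt_source _⟩
  let ϕ : E → F → E' := fun y s => d (g (e.symm y, e'.symm s))
  have key₁ := fun q (hq : q ∈ W) => hasFDerivAt_and_continuousAt_fderiv_chart (g := fun t x => g (x, t))
    h₁ c₁ x₀ (g (x₀, t₀)) (a := e'.symm q.2) (y := q.1) hq.1.1 hq.2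
  have key₂ := fun q (hq : q ∈ W) => hasFDerivAt_and_continuousAt_fderiv_chart (g := fun x t => g (x, t))
    h₂ c₂ t₀ (g (x₀, t₀)) (a := e.symm q.1) (y := q.2) hq.1.2 hq.2
  let f₁ : E → F → E →L[ℝ] E' := fun y s => fderiv ℝ (fun y => ϕ y s) y
  let f₂ : E → F → F →L[ℝ] E' := fun y s => fderiv ℝ (fun s => ϕ y s) s
  have cf₁ : ∀ q ∈ W, ContinuousAt (Function.uncurry f₁) q := fun q hq => by
    have : ContinuousAt (fun q : E × F => (e'.symm q.2, q.1)) q :=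
      (((continuousOn_extChartAt_symm t₀).continuousAt (heo'.mem_nhds hq.1.2)).comp
        continuousAt_snd).prodMk continuousAt_fst
    exact ContinuousAt.comp (x := q) (f := fun q : E × F => (e'.symm q.2, q.1)) (key₁ q hq).2 this
  have cf₂ : ∀ q ∈ W, ContinuousAt (Function.uncurry f₂) q := fun q hq => by
    have : ContinuousAt (fun q : E × F => (e.symm q.1, q.2)) q :=
      (((continuousOn_extChartAt_symm x₀).continuousAt (heo.mem_nhds hq.1.1)).comp
        continuousAt_fst).prodMk continuousAt_snd
    exact ContinuousAt.comp (x := q) (f := fun q : E × F => (e.symm q.1, q.2)) (key₂ q hq).2 this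
  -- Partial derivatives that exist near `q` and are continuous at `q` assemble to a total
  -- derivative.
  have hmain : ∀ q ∈ W, HasFDerivAt (Function.uncurry ϕ)
      ((Function.uncurry f₁ q).coprod (Function.uncurry f₂ q)) q := fun q hq =>
    (hasStrictFDerivAt_uncurry_coprod (f := ϕ) (f₁ := f₁) (f₂ := f₂)
      ((hW.eventually_mem hq).mono fun r hr => (key₁ r hr).1.hasFDerivAt)
      ((hW.eventually_mem hq).mono fun r hr => (key₂ r hr).1.hasFDerivAt)
      (cf₁ q hq) (cf₂ q hq)).hasFDerivAt
  have : ContDiffAt ℝ 1 (Function.uncurry ϕ) (e x₀, e' t₀) :=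
    contDiffAt_one_iff.2 ⟨_, W, hW.mem_nhds hmem, fun q hq =>
      (ContinuousAt.comp (x := q) (f := fun r => (Function.uncurry f₁ r, Function.uncurry f₂ r))
        (ContinuousLinearMap.coprodEquivL ℝ (𝕜 := ℝ) (E := E) (F := F)
          (G := E')).continuous.continuousAt
        ((cf₁ q hq).prodMk (cf₂ q hq))).continuousWithinAt, hmain⟩
  exact this

end JointRegularity

/-! ### Regularity of the inverse of a homeomorphism. -/

section Inverse

variable {E : Type*} [NormedAddCommGroup E] [NormedSpace ℝ E] [CompleteSpace E]
  {H : Type*} [TopologicalSpace H] {I : ModelWithCorners ℝ E H} [I.Boundaryless]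
  {M : Type*} [TopologicalSpace M] [ChartedSpace H M]
  {E' : Type*} [NormedAddCommGroup E'] [NormedSpace ℝ E']
  {H' : Type*} [TopologicalSpace H'] {I' : ModelWithCorners ℝ E' H'} [I'.Boundaryless]
  {M' : Type*} [TopologicalSpace M'] [ChartedSpace H' M']

/-- The inverse of a homeomorphism of class `Cⁿ` is `Cⁿ` where the derivative is invertible. -/
theorem Homeomorph.contMDiffAt_symm {n : ℕ∞ω} (φ : M ≃ₜ M') (hn : n ≠ 0) {x : M}
    (hφ : ContMDiffAt I I' n φ x) (D : E ≃L[ℝ] E')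
    (hD : (D : E →L[ℝ] E') = mfderiv I I' φ x) : ContMDiffAt I' I n φ.symm (φ x) := by
  let e : OpenPartialHomeomorph M E :=
    (chartAt H x).trans I.toHomeomorph.toOpenPartialHomeomorph
  let e' : OpenPartialHomeomorph M' E' :=
    (chartAt H' (φ x)).trans I'.toHomeomorph.toOpenPartialHomeomorph
  -- `φ` read in charts. Its local inverse is the given one, so only the smoothness part of the
  -- inverse function theorem is needed.
  let ψ : OpenPartialHomeomorph E E' := e.symm.trans (φ.toOpenPartialHomeomorph.trans e')
  have hxe : x ∈ e.source := by simp [e]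
  have hxe' : φ x ∈ e'.source := by simp [e']
  have h0 : (e x) ∈ ψ.source := by
    simp [ψ, e, e']
  have h1 : ψ.symm (e' (φ x)) = e x := by
    have := ψ.left_inv h0
    rwa [show ψ (e x) = e' (φ x) by
      change e' (φ (e.symm (e x))) = _
      rw [e.left_inv hxe]] at this
  have ht : e' (φ x) ∈ ψ.target := by
    have := ψ.map_source h0
    rwa [show ψ (e x) = e' (φ x) by
      change e' (φ (e.symm (e x))) = _
      rw [e.left_inv hxe]] at this
  have hr : Set.range I = _root_.Set.univ := I.range_eq_univ
  have hf : ContDiffAt ℝ n ψ (e x) := by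
    have := (contMDiffAt_iff.1 hφ).2
    rw [hr, contDiffWithinAt_univ] at this
    exact this
  have hd : HasFDerivAt ψ (D : E →L[ℝ] E') (e x) := by
    have h2 : HasFDerivWithinAt ψ (D : E →L[ℝ] E') (_root_.Set.range I) (e x) := by
      rw [hD]
      exact (hφ.mdifferentiableAt hn).hasMFDerivAt.2
    rwa [hr, hasFDerivWithinAt_univ] at h2
  rw [contMDiffAt_iff]
  refine ⟨φ.symm.continuous.continuousAt, ContDiffAt.contDiffWithinAt ?_⟩
  rw [φ.symm_apply_apply]
  exact ψ.contDiffAt_symm ht (h1.symm ▸ hd) (h1.symm ▸ hf)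

end Inverse

/-! ### Fixed sections of fibrewise contractions. -/

/-- A fibrewise contraction over `σ` has a fixed section, the limit of its iterates. -/
theorem exists_fixed_section {P : Type*} {V : P → Type*} [∀ p, NormedAddCommGroup (V p)]
    [∀ p, CompleteSpace (V p)] (σ : P → P) {S : ∀ p, Set (V p)} (hS : ∀ p, IsClosed (S p))
    (h0 : ∀ p, 0 ∈ S p) (G : ∀ p, V (σ p) → V p) (hGS : ∀ p, ∀ x ∈ S (σ p), G p x ∈ S p)
    {r K : ℝ} (hr₀ : 0 ≤ r) (hr₁ : r < 1)
    (hG : ∀ p, ∀ x ∈ S (σ p), ∀ y ∈ S (σ p), ‖G p x - G p y‖ ≤ r * ‖x - y‖)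
    (hK : ∀ p, ‖G p 0‖ ≤ K) :
    ∃ L : ∀ p, V p, (∀ p, L p ∈ S p) ∧ (∀ p, L p = G p (L (σ p))) ∧
      ∀ n p, ‖L p - ((fun (l : ∀ p, V p) p => G p (l (σ p)))^[n] 0) p‖ ≤ K / (1 - r) * r ^ n := by
  set Γ : (∀ p, V p) → ∀ p, V p := fun l p => G p (l (σ p)) with hΓ
  have hsucc : ∀ n p, (Γ^[n + 1] 0) p = G p ((Γ^[n] 0) (σ p)) := fun n p => by
    rw [Function.iterate_succ_apply']
  have hmem : ∀ n p, (Γ^[n] 0) p ∈ S p := by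
    intro n
    induction n with
    | zero => exact h0
    | succ n ih => exact fun p => hsucc n p ▸ hGS p _ (ih _)
  have hdist : ∀ n p, dist ((Γ^[n] 0) p) ((Γ^[n + 1] 0) p) ≤ K * r ^ n := by
    intro n
    induction n with
    | zero =>
      intro p
      rw [hsucc, dist_comm, dist_eq_norm, pow_zero, mul_one]
      exact (congrArg norm (sub_zero _)).trans_le (hK p)
    | succ n ih =>
      intro p
      rw [hsucc n, hsucc (n + 1), dist_eq_norm]
      refine (hG p _ (hmem _ _) _ (hmem _ _)).trans ?_
      have := ih (σ p)
      rw [dist_eq_norm] at this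
      calc _ ≤ r * (K * r ^ n) := by gcongr
        _ = _ := by ring
  -- Convergence is taken in each fibre separately; the geometric bound does not depend on `p`,
  -- which gives the uniform rate.
  choose L hL using fun p => cauchySeq_tendsto_of_complete
    (cauchySeq_of_le_geometric r K hr₁ fun n => hdist n p)
  have hLS : ∀ p, L p ∈ S p := fun p =>
    (hS p).mem_of_tendsto (hL p) (Eventually.of_forall fun n => hmem n p)
  refine ⟨L, hLS, fun p => ?_, fun n p => ?_⟩
  · refine tendsto_nhds_unique ((tendsto_add_atTop_iff_nat 1).2 (hL p)) ?_
    rw [tendsto_iff_norm_sub_tendsto_zero]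
    have h1 := (tendsto_iff_norm_sub_tendsto_zero.1 (hL (σ p))).const_mul r
    rw [mul_zero] at h1
    refine squeeze_zero (fun _ => norm_nonneg _) (fun n => ?_) h1
    rw [hsucc]
    exact hG p _ (hmem _ _) _ (hLS _)
  · have := dist_le_of_le_geometric_of_tendsto r K hr₁ (fun n => hdist n p) (hL p) n
    rw [dist_comm, dist_eq_norm] at this
    exact this.trans_eq (by ring)

/-! ### The graph transform for the skew product. -/

section SkewProduct

variable {E : Type*} [NormedAddCommGroup E] [NormedSpace ℝ E]
  {M : Type*} [TopologicalSpace M] [ChartedSpace E M]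
  {F : Type*} [NormedAddCommGroup F] [NormedSpace ℝ F]
  {Ω : Type*} [TopologicalSpace Ω] [ChartedSpace F Ω]

/-- The fibre maps of the inverse of the skew product of `f` and `θ`. -/
def inverseFamily (f : Ω → M ≃ₘ^2⟮𝓘(ℝ, E), 𝓘(ℝ, E)⟯ M) (θ : Ω ≃ₘ^1⟮𝓘(ℝ, F), 𝓘(ℝ, F)⟯ Ω) :
    Ω → M ≃ₘ^2⟮𝓘(ℝ, E), 𝓘(ℝ, E)⟯ M :=
  fun t => (f (θ.symm t)).symm

variable {f : Ω → M ≃ₘ^2⟮𝓘(ℝ, E), 𝓘(ℝ, E)⟯ M} {θ : Ω ≃ₘ^1⟮𝓘(ℝ, F), 𝓘(ℝ, F)⟯ Ω}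

/-- The derivative of a diffeomorphism of `M` at `x`. -/
def fiberDeriv (g : M ≃ₘ^2⟮𝓘(ℝ, E), 𝓘(ℝ, E)⟯ M) (x : M) :
    TangentSpace 𝓘(ℝ, E) x ≃L[ℝ] TangentSpace 𝓘(ℝ, E) (g x) :=
  g.mfderivToContinuousLinearEquiv two_ne_zero x

/-- Chain rule for `g.symm ∘ g = id`. It is phrased in the tangent bundle because `g.symm (g x)` and
`x` are only propositionally equal, so their tangent spaces are different types. -/
theorem tangentMap_symm_fiberDeriv (g : M ≃ₘ^2⟮𝓘(ℝ, E), 𝓘(ℝ, E)⟯ M) (x : M)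
    (η : TangentSpace 𝓘(ℝ, E) (g x)) :
    tangentMap 𝓘(ℝ, E) 𝓘(ℝ, E) g.symm ⟨g x, η⟩ =
      (⟨x, (fiberDeriv g x).symm η⟩ : TangentBundle 𝓘(ℝ, E) M) := by
  obtain ⟨v, rfl⟩ := (fiberDeriv g x).surjective η
  rw [ContinuousLinearEquiv.symm_apply_apply]
  have h := tangentMap_comp_at (I := 𝓘(ℝ, E)) (I' := 𝓘(ℝ, E)) (I'' := 𝓘(ℝ, E)) (f := g)
    (g := g.symm) (⟨x, v⟩ : TangentBundle 𝓘(ℝ, E) M)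
    (g.symm.contMDiff.mdifferentiable two_ne_zero _) (g.contMDiff.mdifferentiable two_ne_zero _)
  rw [show (g.symm ∘ g : M → M) = id from funext g.symm_apply_apply, tangentMap_id] at h
  exact h.symm

theorem mfderiv_family_apply
    (hF : ContMDiff (𝓘(ℝ, E).prod 𝓘(ℝ, F)) 𝓘(ℝ, E) 1 fun p : M × Ω => f p.2 p.1) (p : M × Ω)
    (v : TangentSpace 𝓘(ℝ, E) p.1) (w : TangentSpace 𝓘(ℝ, F) p.2) :
    mfderiv (𝓘(ℝ, E).prod 𝓘(ℝ, F)) 𝓘(ℝ, E) (fun p : M × Ω => f p.2 p.1) p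
      (show TangentSpace (𝓘(ℝ, E).prod 𝓘(ℝ, F)) p from (v, w)) =
    mfderiv 𝓘(ℝ, E) 𝓘(ℝ, E) (f p.2) p.1 v + mfderiv 𝓘(ℝ, F) 𝓘(ℝ, E) (fun t => f t p.1) p.2 w :=
  mfderiv_prod_eq_add_apply (hF.mdifferentiable one_ne_zero p)

variable [IsManifold 𝓘(ℝ, E) 1 M] [IsManifold 𝓘(ℝ, F) 1 Ω]

/-- The partial tangent map is the full one restricted to pairs `(ξ, 0)` under `TM × TΩ ≅ T(M × Ω)`.
-/
theorem continuous_tangentMap_left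
    (hF : ContMDiff (𝓘(ℝ, E).prod 𝓘(ℝ, F)) 𝓘(ℝ, E) 1 fun p : M × Ω => f p.2 p.1) :
    Continuous fun q : TangentBundle 𝓘(ℝ, E) M × Ω =>
      tangentMap 𝓘(ℝ, E) 𝓘(ℝ, E) (f q.2) q.1 := by
  have h1 := hF.continuous_tangentMap le_rfl
  have h2 := (contMDiff_equivTangentBundleProd_symm (I := 𝓘(ℝ, E)) (M := M) (I' := 𝓘(ℝ, F))
    (M' := Ω) (n := 0)).continuous
  have h3 := h1.comp (h2.comp ((continuous_id (X := TangentBundle 𝓘(ℝ, E) M)).prodMap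
    (Bundle.Trivialization.continuous_zeroSection (B := Ω) (F := F) ℝ (E := TangentSpace 𝓘(ℝ, F)))))
  refine h3.congr fun q => ?_
  refine congrArg (TotalSpace.mk _) ?_
  exact (mfderiv_family_apply hF (q.1.1, q.2) q.1.2 0).trans (by rw [map_zero, add_zero])

theorem continuous_tangentMap_right
    (hF : ContMDiff (𝓘(ℝ, E).prod 𝓘(ℝ, F)) 𝓘(ℝ, E) 1 fun p : M × Ω => f p.2 p.1) :
    Continuous fun q : M × TangentBundle 𝓘(ℝ, F) Ω =>
      tangentMap 𝓘(ℝ, F) 𝓘(ℝ, E) (fun t => f t q.1) q.2 := by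
  have h1 := hF.continuous_tangentMap le_rfl
  have h2 := (contMDiff_equivTangentBundleProd_symm (I := 𝓘(ℝ, E)) (M := M) (I' := 𝓘(ℝ, F))
    (M' := Ω) (n := 0)).continuous
  have h3 := h1.comp (h2.comp ((Bundle.Trivialization.continuous_zeroSection (B := M) (F := E) ℝ
    (E := TangentSpace 𝓘(ℝ, E))).prodMap (continuous_id (X := TangentBundle 𝓘(ℝ, F) Ω))))
  refine h3.congr fun q => ?_
  refine congrArg (TotalSpace.mk _) ?_
  exact (mfderiv_family_apply hF (q.1, q.2.1) 0 q.2.2).trans (by rw [map_zero, zero_add])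

variable [FiniteDimensional ℝ E] [CompactSpace M] [CompactSpace Ω]
  [RiemannianBundle (fun x : M => TangentSpace 𝓘(ℝ, E) x)]
  [IsContinuousRiemannianBundle E (fun x : M => TangentSpace 𝓘(ℝ, E) x)]
  [RiemannianBundle (fun t : Ω => TangentSpace 𝓘(ℝ, F) t)]
  [IsContinuousRiemannianBundle F (fun t : Ω => TangentSpace 𝓘(ℝ, F) t)]

/-- If the fibre maps expand the invariant subbundle `U` more than `θ` expands `Ω`, then there is a
continuous graph over `TΩ` with values in `U` which is invariant modulo the complement `S`. -/
theorem exists_invariant_graph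
    (hF : ContMDiff (𝓘(ℝ, E).prod 𝓘(ℝ, F)) 𝓘(ℝ, E) 1 fun p : M × Ω => f p.2 p.1)
    (hF' : ContMDiff (𝓘(ℝ, E).prod 𝓘(ℝ, F)) 𝓘(ℝ, E) 1 fun p : M × Ω => inverseFamily f θ p.2 p.1)
    {S U : ∀ p : M × Ω, Submodule ℝ (TangentSpace 𝓘(ℝ, E) p.1)}
    (hS : IsContinuousSubbundle E (fun x : M => TangentSpace 𝓘(ℝ, E) x) Prod.fst S)
    (hU : IsContinuousSubbundle E (fun x : M => TangentSpace 𝓘(ℝ, E) x) Prod.fst U)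
    (hSU : ∀ p, IsCompl (S p) (U p))
    (hinv : ∀ p : M × Ω, (U p).map (mfderiv 𝓘(ℝ, E) 𝓘(ℝ, E) (f p.2) p.1).toLinearMap =
      U (f p.2 p.1, θ p.2))
    {a c : ℝ} (ha : 0 ≤ a) (hac : a < c)
    (hθ : ∀ (t : Ω) (w : TangentSpace 𝓘(ℝ, F) t), ‖mfderiv 𝓘(ℝ, F) 𝓘(ℝ, F) θ t w‖ ≤ a * ‖w‖)
    (hf : ∀ p : M × Ω, ∀ v ∈ U p, c * ‖v‖ ≤ ‖mfderiv 𝓘(ℝ, E) 𝓘(ℝ, E) (f p.2) p.1 v‖) :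
    ∃ L : ∀ p : M × Ω, TangentSpace 𝓘(ℝ, F) p.2 →L[ℝ] TangentSpace 𝓘(ℝ, E) p.1,
      (∀ p w, L p w ∈ U p) ∧
      (Continuous fun q : M × TangentBundle 𝓘(ℝ, F) Ω =>
        (⟨q.1, L (q.1, q.2.1) q.2.2⟩ : TangentBundle 𝓘(ℝ, E) M)) ∧
      ∀ (p : M × Ω) (w : TangentSpace 𝓘(ℝ, F) p.2),
        mfderiv 𝓘(ℝ, E) 𝓘(ℝ, E) (f p.2) p.1 (L p w) +
          (U (f p.2 p.1, θ p.2)).projection (S (f p.2 p.1, θ p.2)) (hSU (f p.2 p.1, θ p.2)).symm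
            (mfderiv 𝓘(ℝ, F) 𝓘(ℝ, E) (fun t => f t p.1) p.2 w) =
        L (f p.2 p.1, θ p.2) (mfderiv 𝓘(ℝ, F) 𝓘(ℝ, F) θ p.2 w) := by
  have (x : M) : FiniteDimensional ℝ (TangentSpace 𝓘(ℝ, E) x) := inferInstanceAs (FiniteDimensional ℝ E)
  have (x : M) : CompleteSpace (TangentSpace 𝓘(ℝ, E) x) := FiniteDimensional.complete ℝ _
  have hc : 0 < c := ha.trans_lt hac
  let V : M × Ω → Type _ := fun p => TangentSpace 𝓘(ℝ, F) p.2 →L[ℝ] TangentSpace 𝓘(ℝ, E) p.1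
  let σ : M × Ω → M × Ω := fun p => (f p.2 p.1, θ p.2)
  let A : ∀ p : M × Ω, TangentSpace 𝓘(ℝ, E) p.1 ≃L[ℝ] TangentSpace 𝓘(ℝ, E) (f p.2 p.1) := fun p =>
    fiberDeriv (f p.2) p.1
  let Bd : ∀ p : M × Ω, TangentSpace 𝓘(ℝ, F) p.2 →L[ℝ] TangentSpace 𝓘(ℝ, E) (f p.2 p.1) := fun p =>
    mfderiv 𝓘(ℝ, F) 𝓘(ℝ, E) (fun t => f t p.1) p.2
  let T : ∀ p : M × Ω, TangentSpace 𝓘(ℝ, F) p.2 →L[ℝ] TangentSpace 𝓘(ℝ, F) (θ p.2) := fun p =>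
    mfderiv 𝓘(ℝ, F) 𝓘(ℝ, F) θ p.2
  let Pr : ∀ p : M × Ω, TangentSpace 𝓘(ℝ, E) p.1 →L[ℝ] TangentSpace 𝓘(ℝ, E) p.1 := fun p =>
    ((U p).projection (S p) (hSU p).symm).toContinuousLinearMap
  -- The required identity `A X_p + P_U B = X_{σ p} T` solved for `X_p`. On maps with values in `U`,
  -- `A⁻¹` contributes at most `1 / c` and `T` at most `a`, whence the ratio `a / c`.
  let G : ∀ p, V (σ p) → V p := fun p X =>
    ((A p).symm : TangentSpace 𝓘(ℝ, E) (f p.2 p.1) →L[ℝ] TangentSpace 𝓘(ℝ, E) p.1).comp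
      (ContinuousLinearMap.comp X (T p) - (Pr (σ p)).comp (Bd p))
  have hGapp : ∀ p X w, G p X w = (A p).symm (X (T p w) - Pr (σ p) (Bd p w)) := fun _ _ _ => rfl
  have hAsymm : ∀ p, ∀ z ∈ U (σ p), (A p).symm z ∈ U p ∧ c * ‖(A p).symm z‖ ≤ ‖z‖ := by
    intro p z hz
    rw [← hinv p] at hz
    obtain ⟨v, hv, rfl⟩ := hz
    have : (A p).symm (A p v) = v := (A p).symm_apply_apply v
    change (A p).symm (A p v) ∈ U p ∧ c * ‖(A p).symm (A p v)‖ ≤ ‖A p v‖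
    rw [this]
    exact ⟨hv, hf p v hv⟩
  let Z : ∀ p, Set (V p) := fun p => {X | ∀ w, X w ∈ U p}
  have hZ : ∀ p, IsClosed (Z p) := fun p => by
    have : Z p = ⋂ w, {X : V p | X w ∈ U p} := by ext; simp [Z]
    rw [this]
    exact isClosed_iInter fun w => (U p).closed_of_finiteDimensional.preimage
      (ContinuousLinearMap.apply ℝ (TangentSpace 𝓘(ℝ, E) p.1) w).continuous
  have hGZ : ∀ p, ∀ X ∈ Z (σ p), G p X ∈ Z p := fun p X hX w =>
    (hAsymm p _ ((U (σ p)).sub_mem (hX _) (Submodule.projection_apply_mem _ _))).1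
  have hlip : ∀ p, ∀ X ∈ Z (σ p), ∀ Y ∈ Z (σ p), ‖G p X - G p Y‖ ≤ a / c * ‖X - Y‖ := by
    intro p X hX Y hY
    refine ContinuousLinearMap.opNorm_le_bound _ (by positivity) fun w => ?_
    have h1 : (G p X - G p Y) w = (A p).symm ((X - Y) (T p w)) := by
      rw [sub_apply, hGapp, hGapp, ← map_sub, sub_sub_sub_cancel_right]
      rfl
    rw [h1]
    have h2 := (hAsymm p ((X - Y) (T p w)) ((U (σ p)).sub_mem (hX _) (hY _))).2
    have h3 : ‖(X - Y) (T p w)‖ ≤ ‖X - Y‖ * (a * ‖w‖) :=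
      ((X - Y).le_opNorm _).trans (by gcongr; exact hθ p.2 w)
    rw [div_mul_eq_mul_div, div_mul_eq_mul_div, le_div_iff₀ hc]
    linarith
  let Cont : (∀ p, V p) → Prop := fun l => Continuous fun q : M × TangentBundle 𝓘(ℝ, F) Ω =>
    (⟨q.1, l (q.1, q.2.1) q.2.2⟩ : TangentBundle 𝓘(ℝ, E) M)
  have hproj : Continuous fun q : M × TangentBundle 𝓘(ℝ, F) Ω => (q.1, q.2.1) :=
    continuous_id.prodMap (FiberBundle.continuous_proj F (TangentSpace 𝓘(ℝ, F) (M := Ω)))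
  have hσ : Continuous σ := hF.continuous.prodMk (θ.continuous.comp continuous_snd)
  have hT := θ.contMDiff.continuous_tangentMap le_rfl
  have hB := continuous_tangentMap_right hF
  -- `A⁻¹` is the fibre derivative of the inverse skew product at the image point, so its continuity
  -- comes from `hF'`.
  have hA := continuous_tangentMap_left hF'
  have hContG : ∀ l, Cont l → Cont fun p => G p (l (σ p)) := by
    intro l hl
    have s1 : Continuous fun q : M × TangentBundle 𝓘(ℝ, F) Ω =>
        (⟨f q.2.1 q.1, l (σ (q.1, q.2.1)) (T (q.1, q.2.1) q.2.2)⟩ : TangentBundle 𝓘(ℝ, E) M) :=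
      hl.comp ((hF.continuous.comp hproj).prodMk (hT.comp continuous_snd))
    have s4 : Continuous fun q : M × TangentBundle 𝓘(ℝ, F) Ω =>
        (⟨f q.2.1 q.1, l (σ (q.1, q.2.1)) (T (q.1, q.2.1) q.2.2) -
          Pr (σ (q.1, q.2.1)) (Bd (q.1, q.2.1) q.2.2)⟩ : TangentBundle 𝓘(ℝ, E) M) :=
      continuous_iff_continuousAt.2 fun q => s1.continuousAt.sub_section
        (ContinuousAt.proj_section (c := fun q : M × TangentBundle 𝓘(ℝ, F) Ω => σ (q.1, q.2.1))
          continuous_fst hS hU hSU (hσ.comp hproj).continuousAt hB.continuousAt)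
    have s5 := hA.comp (s4.prodMk (θ.continuous.comp
      ((FiberBundle.continuous_proj F (TangentSpace 𝓘(ℝ, F) (M := Ω))).comp continuous_snd)))
    refine s5.congr fun q => ?_
    refine Eq.trans ?_ (tangentMap_symm_fiberDeriv (f q.2.1) q.1 _)
    simp only [Function.comp_apply, inverseFamily, Diffeomorph.symm_apply_apply]
    rfl
  have hCont0 : Cont 0 := by
    refine continuous_iff_continuousAt.2 fun q => ?_
    exact ContinuousAt.zero_section continuous_fst.continuousAt
  -- The inhomogeneous term `G p 0 = -A⁻¹ P_U B` is a continuous bundle map over a compact base,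
  -- hence bounded.
  obtain ⟨K, hK⟩ := exists_opNorm_le_of_continuous
    (fun p => G p ((0 : ∀ p, V p) (σ p))) (hContG 0 hCont0)
  have hGK : ∀ p, ‖G p 0‖ ≤ K := hK
  clear hK
  clear_value G
  obtain ⟨L, hLZ, hL, hLn⟩ := exists_fixed_section (V := V) σ (S := Z) hZ
    (fun p _ => (U p).zero_mem) G hGZ
    (r := a / c) (K := K) (by positivity) ((div_lt_one hc).2 hac) hlip hGK
  refine ⟨L, hLZ, ?_, ?_⟩
  · have hiter : ∀ n, Cont ((fun (l : ∀ p, V p) p => G p (l (σ p)))^[n] 0) := by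
      intro n
      induction n with
      | zero => exact hCont0
      | succ n ih =>
        rw [Function.iterate_succ_apply']
        exact hContG _ ih
    refine continuous_iff_continuousAt.2 fun q₀ => ?_
    refine ContinuousAt.section_of_approx continuous_fst.continuousAt fun ε hε => ?_
    -- The operator-norm estimate is uniform only on vectors of bounded length; near `q₀` lengths
    -- stay below `‖q₀.2.2‖ + 1`.
    have hlim : Tendsto (fun n : ℕ => K / (1 - a / c) * (a / c) ^ n * (‖q₀.2.2‖ + 1)) atTop (𝓝 0) := by
      have := ((tendsto_pow_atTop_nhds_zero_of_lt_one (by positivity)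
        ((div_lt_one hc).2 hac)).const_mul (K / (1 - a / c))).mul_const (‖q₀.2.2‖ + 1)
      simpa using this
    obtain ⟨n, hn⟩ := (hlim.eventually_le_const hε).exists
    refine ⟨_, (hiter n).continuousAt, ?_⟩
    have hnorm : Continuous fun q : M × TangentBundle 𝓘(ℝ, F) Ω => ‖q.2.2‖ :=
      continuous_norm_totalSpace.comp continuous_snd
    filter_upwards [hnorm.continuousAt.eventually_lt continuousAt_const (lt_add_one ‖q₀.2.2‖)]
      with q hq
    rw [← sub_apply]
    refine (ContinuousLinearMap.le_opNorm _ _).trans (le_trans ?_ hn)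
    have h5 := hLn n (q.1, q.2.1)
    have h6 : 0 ≤ K / (1 - a / c) * (a / c) ^ n :=
      (ContinuousLinearMap.opNorm_nonneg _).trans h5
    exact mul_le_mul h5 hq.le (norm_nonneg _) h6
  · intro p w
    have h1 : L p w = (A p).symm (L (σ p) (T p w) - Pr (σ p) (Bd p w)) := by
      rw [← hGapp, ← hL]
    have h2 : A p (L p w) = L (σ p) (T p w) - Pr (σ p) (Bd p w) := by
      rw [h1, ContinuousLinearEquiv.apply_symm_apply]
    exact eq_sub_iff_add_eq.1 h2

end SkewProduct

/-! ### Derivative estimates for iterates. -/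

section Iterates

variable {E : Type*} [NormedAddCommGroup E] [NormedSpace ℝ E]
  {H : Type*} [TopologicalSpace H] {I : ModelWithCorners ℝ E H}
  {N : Type*} [TopologicalSpace N] [ChartedSpace H N]

/-- A bound for the derivative on an invariant family of subspaces, iterated. -/
theorem mfderiv_iterate_le {φ : N → N} (hφ : MDifferentiable I I φ)
    {S : ∀ p : N, Submodule ℝ (TangentSpace I p)} {h : ∀ p : N, TangentSpace I p → ℝ} {r : ℝ}
    (hr : 0 ≤ r) (hS : ∀ p, ∀ v ∈ S p, mfderiv I I φ p v ∈ S (φ p))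
    (hh : ∀ p, ∀ v ∈ S p, h (φ p) (mfderiv I I φ p v) ≤ r * h p v) (n : ℕ) (p : N)
    {v : TangentSpace I p} (hv : v ∈ S p) :
    mfderiv I I (φ^[n]) p v ∈ S (φ^[n] p) ∧
      h (φ^[n] p) (mfderiv I I (φ^[n]) p v) ≤ r ^ n * h p v := by
  have hit : ∀ n, MDifferentiable I I (φ^[n]) := by
    intro n
    induction n with
    | zero => exact mdifferentiable_id
    | succ n ih => rw [Function.iterate_succ']; exact hφ.comp ih
  induction n with
  | zero =>
    rw [Function.iterate_zero, mfderiv_id, pow_zero, one_mul]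
    exact ⟨hv, le_rfl⟩
  | succ n ih =>
    rw [Function.iterate_succ', mfderiv_comp p (hφ _) (hit n p)]
    refine ⟨hS _ _ ih.1, (hh _ _ ih.1).trans ?_⟩
    rw [pow_succ', mul_assoc]
    exact mul_le_mul_of_nonneg_left ih.2 hr

end Iterates

/-! ### The inverse skew product and its invariant subbundles. -/

section Inverse

variable {E : Type*} [NormedAddCommGroup E] [NormedSpace ℝ E]
  {M : Type*} [TopologicalSpace M] [ChartedSpace E M]
  {F : Type*} [NormedAddCommGroup F] [NormedSpace ℝ F]
  {Ω : Type*} [TopologicalSpace Ω] [ChartedSpace F Ω]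
  {f : Ω → M ≃ₘ^2⟮𝓘(ℝ, E), 𝓘(ℝ, E)⟯ M} {θ : Ω ≃ₘ^1⟮𝓘(ℝ, F), 𝓘(ℝ, F)⟯ Ω}

theorem inverseFamily_inverseFamily : inverseFamily (inverseFamily f θ) θ.symm = f := by
  funext t
  ext x
  change f (θ.symm (θ t)) x = f t x
  rw [θ.symm_apply_apply]

theorem tangentMap_symm_tangentMap {n : ℕ∞ω} (hn : n ≠ 0) (g : Ω ≃ₘ^n⟮𝓘(ℝ, F), 𝓘(ℝ, F)⟯ Ω)
    (ξ : TangentBundle 𝓘(ℝ, F) Ω) :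
    tangentMap 𝓘(ℝ, F) 𝓘(ℝ, F) g.symm (tangentMap 𝓘(ℝ, F) 𝓘(ℝ, F) g ξ) = ξ := by
  have h := tangentMap_comp_at (I := 𝓘(ℝ, F)) (I' := 𝓘(ℝ, F)) (I'' := 𝓘(ℝ, F)) (f := g)
    (g := g.symm) ξ (g.symm.contMDiff.mdifferentiable hn _) (g.contMDiff.mdifferentiable hn _)
  rw [show (g.symm ∘ g : Ω → Ω) = id from funext g.symm_apply_apply, tangentMap_id] at h
  exact h.symm

variable {S : ∀ p : M × Ω, Submodule ℝ (TangentSpace 𝓘(ℝ, E) p.1)}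

theorem map_mfderiv_inverseFamily
    (hS : ∀ p : M × Ω, (S p).map (mfderiv 𝓘(ℝ, E) 𝓘(ℝ, E) (f p.2) p.1).toLinearMap =
      S (f p.2 p.1, θ p.2)) (p : M × Ω) :
    (S p).map (mfderiv 𝓘(ℝ, E) 𝓘(ℝ, E) (inverseFamily f θ p.2) p.1).toLinearMap =
      S (inverseFamily f θ p.2 p.1, θ.symm p.2) := by
  -- Separate names for `θ.symm (θ t)` and `t` let their equality be eliminated by substitution,
  -- without transporting between tangent spaces.
  have key : ∀ (s t : Ω) (y : M), s = t →
      (S (f t y, θ t)).map (mfderiv 𝓘(ℝ, E) 𝓘(ℝ, E) (f s).symm (f t y)).toLinearMap =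
        S ((f s).symm (f t y), s) := by
    rintro s t y rfl
    have key₂ : ∀ ξ : TangentBundle 𝓘(ℝ, E) M, ξ.1 = y → ξ.2 ∈ S (ξ.1, s) →
        ∃ u ∈ S (y, s), (⟨y, u⟩ : TangentBundle 𝓘(ℝ, E) M) = ξ := by
      rintro ⟨_, u⟩ rfl hu
      exact ⟨u, hu, rfl⟩
    ext z
    constructor
    · rintro ⟨v, hv, rfl⟩
      rw [← hS (y, s)] at hv
      obtain ⟨u, hu, rfl⟩ := hv
      have h := tangentMap_symm_tangentMap two_ne_zero (f s) ⟨y, u⟩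
      have h2 : (tangentMap 𝓘(ℝ, E) 𝓘(ℝ, E) (f s).symm (tangentMap 𝓘(ℝ, E) 𝓘(ℝ, E) (f s) ⟨y, u⟩)).2 ∈
          S ((tangentMap 𝓘(ℝ, E) 𝓘(ℝ, E) (f s).symm (tangentMap 𝓘(ℝ, E) 𝓘(ℝ, E) (f s) ⟨y, u⟩)).1, s) := by
        rw [h]
        exact hu
      exact h2
    · intro hz
      obtain ⟨u, hu, huz⟩ := key₂ ⟨_, z⟩ ((f s).symm_apply_apply y) hz
      refine ⟨mfderiv 𝓘(ℝ, E) 𝓘(ℝ, E) (f s) y u, ?_, ?_⟩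
      · rw [SetLike.mem_coe, ← hS (y, s)]
        exact ⟨u, hu, rfl⟩
      · have h := (tangentMap_symm_tangentMap two_ne_zero (f s) ⟨y, u⟩).trans huz
        exact TotalSpace.mk_injective _ h
  obtain ⟨x, t'⟩ := p
  obtain ⟨t, rfl⟩ := θ.surjective t'
  obtain ⟨y, rfl⟩ := (f t).surjective x
  exact key (θ.symm (θ t)) t y (θ.symm_apply_apply t)

/-- By invariance every `v ∈ S p` is the image of a vector of `S` at the preimage of `p`, and the
inverse derivative returns that vector. Applied to the inverse family, the lemma yields lower bounds
for `f` itself. -/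
theorem le_norm_mfderiv_inverseFamily [RiemannianBundle (fun x : M => TangentSpace 𝓘(ℝ, E) x)]
    (hS : ∀ p : M × Ω, (S p).map (mfderiv 𝓘(ℝ, E) 𝓘(ℝ, E) (f p.2) p.1).toLinearMap =
      S (f p.2 p.1, θ p.2)) {a : ℝ} (ha : 0 < a)
    (hf : ∀ p : M × Ω, ∀ v ∈ S p, ‖mfderiv 𝓘(ℝ, E) 𝓘(ℝ, E) (f p.2) p.1 v‖ ≤ a * ‖v‖)
    (p : M × Ω) (v : TangentSpace 𝓘(ℝ, E) p.1) (hv : v ∈ S p) :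
    a⁻¹ * ‖v‖ ≤ ‖mfderiv 𝓘(ℝ, E) 𝓘(ℝ, E) (inverseFamily f θ p.2) p.1 v‖ := by
  have key : ∀ (s t : Ω) (y : M), s = t → ∀ v ∈ S (f t y, θ t),
      a⁻¹ * ‖v‖ ≤ ‖mfderiv 𝓘(ℝ, E) 𝓘(ℝ, E) (f s).symm (f t y) v‖ := by
    rintro s t y rfl v hv
    rw [← hS (y, s)] at hv
    obtain ⟨u, hu, rfl⟩ := hv
    have h := congrArg (fun ξ : TangentBundle 𝓘(ℝ, E) M => ‖ξ.2‖)
      (tangentMap_symm_tangentMap two_ne_zero (f s) ⟨y, u⟩)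
    refine le_trans ?_ h.ge
    rw [inv_mul_le_iff₀ ha]
    exact hf (y, s) u hu
  obtain ⟨x, t'⟩ := p
  obtain ⟨t, rfl⟩ := θ.surjective t'
  obtain ⟨y, rfl⟩ := (f t).surjective x
  exact key (θ.symm (θ t)) t y (θ.symm_apply_apply t) v hv

end Inverse

/-! ### The skew product is a `C¹` diffeomorphism. -/

section Regularity

variable {E : Type*} [NormedAddCommGroup E] [NormedSpace ℝ E]
  {M : Type*} [TopologicalSpace M] [ChartedSpace E M]
  {F : Type*} [NormedAddCommGroup F] [NormedSpace ℝ F]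
  {Ω : Type*} [TopologicalSpace Ω] [ChartedSpace F Ω]
  {f : Ω → M ≃ₘ^2⟮𝓘(ℝ, E), 𝓘(ℝ, E)⟯ M} {θ : Ω ≃ₘ^1⟮𝓘(ℝ, F), 𝓘(ℝ, F)⟯ Ω}

theorem contMDiff_skewProduct
    (hF : ContMDiff (𝓘(ℝ, E).prod 𝓘(ℝ, F)) 𝓘(ℝ, E) 1 fun p : M × Ω => f p.2 p.1) :
    ContMDiff (𝓘(ℝ, E).prod 𝓘(ℝ, F)) (𝓘(ℝ, E).prod 𝓘(ℝ, F)) 1 (skewProduct f θ) :=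
  hF.prodMk (θ.contMDiff.comp contMDiff_snd)

theorem mfderiv_skewProduct_apply
    (hF : ContMDiff (𝓘(ℝ, E).prod 𝓘(ℝ, F)) 𝓘(ℝ, E) 1 fun p : M × Ω => f p.2 p.1) (p : M × Ω)
    (v : TangentSpace 𝓘(ℝ, E) p.1) (w : TangentSpace 𝓘(ℝ, F) p.2) :
    mfderiv (𝓘(ℝ, E).prod 𝓘(ℝ, F)) (𝓘(ℝ, E).prod 𝓘(ℝ, F)) (skewProduct f θ) p
      (show TangentSpace (𝓘(ℝ, E).prod 𝓘(ℝ, F)) p from (v, w)) =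
    (show TangentSpace (𝓘(ℝ, E).prod 𝓘(ℝ, F)) (skewProduct f θ p) from
      (mfderiv 𝓘(ℝ, E) 𝓘(ℝ, E) (f p.2) p.1 v + mfderiv 𝓘(ℝ, F) 𝓘(ℝ, E) (fun t => f t p.1) p.2 w,
        mfderiv 𝓘(ℝ, F) 𝓘(ℝ, F) θ p.2 w)) := by
  have h1 := hF.mdifferentiable one_ne_zero p
  have h2 : MDifferentiableAt (𝓘(ℝ, E).prod 𝓘(ℝ, F)) 𝓘(ℝ, F) (fun p : M × Ω => θ p.2) p :=
    (θ.contMDiff.comp contMDiff_snd).mdifferentiable one_ne_zero p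
  have h3 := h1.mfderiv_prod h2
  have h4 : mfderiv (𝓘(ℝ, E).prod 𝓘(ℝ, F)) 𝓘(ℝ, F) (fun p : M × Ω => θ p.2) p =
      (mfderiv 𝓘(ℝ, F) 𝓘(ℝ, F) θ p.2).comp
        (mfderiv (𝓘(ℝ, E).prod 𝓘(ℝ, F)) 𝓘(ℝ, F) (Prod.snd : M × Ω → Ω) p) :=
    mfderiv_comp p (θ.contMDiff.mdifferentiable one_ne_zero _) mdifferentiableAt_snd
  rw [mfderiv_snd] at h4
  refine (DFunLike.congr_fun h3 _).trans (Prod.ext ?_ ?_)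
  · exact mfderiv_family_apply hF p v w
  · exact DFunLike.congr_fun h4 _

variable [FiniteDimensional ℝ E] [FiniteDimensional ℝ F] [CompactSpace M] [CompactSpace Ω]
  [T2Space M] [T2Space Ω]

/-- A continuous bijection of a compact Hausdorff space is a homeomorphism. The derivative is block
triangular with invertible diagonal blocks, so it is injective, hence bijective by finite dimension,
and the inverse is `C¹` at every point. -/
theorem contMDiff_skewProduct_symm
    (hF : ContMDiff (𝓘(ℝ, E).prod 𝓘(ℝ, F)) 𝓘(ℝ, E) 1 fun p : M × Ω => f p.2 p.1) :
    ContMDiff (𝓘(ℝ, E).prod 𝓘(ℝ, F)) (𝓘(ℝ, E).prod 𝓘(ℝ, F)) 1 (skewProduct f θ).symm := by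
  have hφ := contMDiff_skewProduct (θ := θ) hF
  let φ : M × Ω ≃ₜ M × Ω := hφ.continuous.homeoOfEquivCompactToT2
  intro q
  obtain ⟨p, rfl⟩ := φ.surjective q
  let D : E × F →L[ℝ] E × F :=
    mfderiv (𝓘(ℝ, E).prod 𝓘(ℝ, F)) (𝓘(ℝ, E).prod 𝓘(ℝ, F)) (skewProduct f θ) p
  have haux : ∀ (v : TangentSpace 𝓘(ℝ, E) p.1) (w : TangentSpace 𝓘(ℝ, F) p.2),
      mfderiv 𝓘(ℝ, E) 𝓘(ℝ, E) (f p.2) p.1 v + mfderiv 𝓘(ℝ, F) 𝓘(ℝ, E) (fun t => f t p.1) p.2 w = 0 →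
      mfderiv 𝓘(ℝ, F) 𝓘(ℝ, F) θ p.2 w = 0 → v = 0 ∧ w = 0 := by
    intro v w h1 h2
    have hw : w = 0 := (θ.mfderivToContinuousLinearEquiv one_ne_zero p.2).map_eq_zero_iff.1 h2
    subst hw
    rw [map_zero, add_zero] at h1
    exact ⟨(fiberDeriv (f p.2) p.1).map_eq_zero_iff.1 h1, rfl⟩
  have hinj : Function.Injective D := by
    rw [injective_iff_map_eq_zero]
    rintro ⟨v, w⟩ h
    have h' := (mfderiv_skewProduct_apply (θ := θ) hF p v w).symm.trans h
    obtain ⟨hv, hw⟩ := haux v w (congrArg Prod.fst h') (congrArg Prod.snd h')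
    exact Prod.ext hv hw
  let D' : (E × F) ≃L[ℝ] (E × F) := ContinuousLinearEquiv.ofBijective D
    (LinearMap.ker_eq_bot.2 hinj)
    (LinearMap.range_eq_top.2 ((LinearMap.injective_iff_surjective (f := D.toLinearMap)).1 hinj))
  exact φ.contMDiffAt_symm one_ne_zero (hφ p) D' (ContinuousLinearEquiv.coe_ofBijective D _ _)

theorem contMDiff_inverseFamily
    (hF : ContMDiff (𝓘(ℝ, E).prod 𝓘(ℝ, F)) 𝓘(ℝ, E) 1 fun p : M × Ω => f p.2 p.1) :
    ContMDiff (𝓘(ℝ, E).prod 𝓘(ℝ, F)) 𝓘(ℝ, E) 1 fun p : M × Ω => inverseFamily f θ p.2 p.1 :=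
  contMDiff_fst.comp (contMDiff_skewProduct_symm (θ := θ) hF)

end Regularity

section Family

variable {E : Type*} [NormedAddCommGroup E] [NormedSpace ℝ E] [FiniteDimensional ℝ E]
  {M : Type*} [TopologicalSpace M] [ChartedSpace E M] [IsManifold 𝓘(ℝ, E) ∞ M]
  {F : Type*} [NormedAddCommGroup F] [NormedSpace ℝ F] [FiniteDimensional ℝ F]
  {Ω : Type*} [TopologicalSpace Ω] [ChartedSpace F Ω] [IsManifold 𝓘(ℝ, F) ∞ Ω]
  {f : Ω → M ≃ₘ^2⟮𝓘(ℝ, E), 𝓘(ℝ, E)⟯ M}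

/-- The base point of `TTf_ω` on the zero section of `TTM` is `Tf_ω`, so `C²` continuity contains
joint continuity of the tangent maps along `M`; `hb` supplies those along `Ω`. -/
theorem IsC2Continuous.contMDiff_uncurry (hf : IsC2Continuous f)
    (hb : IsC1InParameter (I := 𝓘(ℝ, E)) (J := 𝓘(ℝ, F)) fun (t : Ω) (x : M) => f t x) :
    ContMDiff (𝓘(ℝ, E).prod 𝓘(ℝ, F)) 𝓘(ℝ, E) 1 fun p : M × Ω => f p.2 p.1 := by
  refine contMDiff_one_of_partial (fun t => (f t).contMDiff.mdifferentiable two_ne_zero)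
    (fun x => (hb.1 x).mdifferentiable one_ne_zero) ?_ hb.2
  have h0 := Bundle.Trivialization.continuous_zeroSection (B := TangentBundle 𝓘(ℝ, E) M)
    (F := E × E) ℝ (E := TangentSpace 𝓘(ℝ, E).tangent)
  have hp := FiberBundle.continuous_proj (E × E)
    (TangentSpace 𝓘(ℝ, E).tangent (M := TangentBundle 𝓘(ℝ, E) M))
  exact hp.comp (hf.comp (continuous_id.prodMap h0))

end Family

/-! ### The splitting of the product tangent bundle and its continuity. -/

theorem isInternal_three {W : Type*} [AddCommGroup W] [Module ℝ W] {A B C : Submodule ℝ W}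
    (hsum : ∀ z, ∃ a ∈ A, ∃ b ∈ B, ∃ c ∈ C, a + b + c = z)
    (hzero : ∀ a ∈ A, ∀ b ∈ B, ∀ c ∈ C, a + b + c = 0 → a = 0 ∧ b = 0 ∧ c = 0) :
    DirectSum.IsInternal ![A, B, C] := by
  classical
  have hcoe : ∀ x : DirectSum (Fin 3) fun i => ![A, B, C] i, DirectSum.coeAddMonoidHom ![A, B, C] x =
      (x 0 : W) + (x 1 : W) + (x 2 : W) := by
    intro x
    rw [DirectSum.coeAddMonoidHom_eq_dfinsuppSum, DFinsupp.sum_eq_sum_fintype _ (fun _ => rfl),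
      Fin.sum_univ_three]
    rfl
  constructor
  · rw [injective_iff_map_eq_zero]
    intro x hx
    rw [hcoe] at hx
    obtain ⟨h0, h1, h2⟩ := hzero _ (x 0).2 _ (x 1).2 _ (x 2).2 hx
    refine DFinsupp.ext fun i => ?_
    fin_cases i
    · exact Subtype.ext h0
    · exact Subtype.ext h1
    · exact Subtype.ext h2
  · intro z
    obtain ⟨a, ha, b, hb, c, hc, rfl⟩ := hsum z
    let x (i : Fin 3) (w : ![A, B, C] i) := DirectSum.of (fun i => ![A, B, C] i) i w
    refine ⟨x 0 ⟨a, ha⟩ + x 1 ⟨b, hb⟩ + x 2 ⟨c, hc⟩, ?_⟩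
    simp only [x, map_add, DirectSum.coeAddMonoidHom_of]

section Subbundles

variable {E : Type*} [NormedAddCommGroup E] [NormedSpace ℝ E]
  {M : Type*} [TopologicalSpace M] [ChartedSpace E M]
  {F : Type*} [NormedAddCommGroup F] [NormedSpace ℝ F]
  {Ω : Type*} [TopologicalSpace Ω] [ChartedSpace F Ω]

/-- The graph of a family of linear maps `T_ω Ω → T_x M`. -/
def graphBundle (L : ∀ p : M × Ω, TangentSpace 𝓘(ℝ, F) p.2 →L[ℝ] TangentSpace 𝓘(ℝ, E) p.1)
    (p : M × Ω) : Submodule ℝ (TangentSpace (𝓘(ℝ, E).prod 𝓘(ℝ, F)) p) :=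
  LinearMap.range ((L p).prod (ContinuousLinearMap.id ℝ (TangentSpace 𝓘(ℝ, F) p.2))).toLinearMap

variable {L : ∀ p : M × Ω, TangentSpace 𝓘(ℝ, F) p.2 →L[ℝ] TangentSpace 𝓘(ℝ, E) p.1}

theorem mk_mem_graphBundle (p : M × Ω) (w : TangentSpace 𝓘(ℝ, F) p.2) :
    (show TangentSpace (𝓘(ℝ, E).prod 𝓘(ℝ, F)) p from (L p w, w)) ∈ graphBundle L p :=
  ⟨w, rfl⟩

theorem exists_of_mem_graphBundle {p : M × Ω} {z : TangentSpace (𝓘(ℝ, E).prod 𝓘(ℝ, F)) p}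
    (hz : z ∈ graphBundle L p) : ∃ w : TangentSpace 𝓘(ℝ, F) p.2,
      z = (show TangentSpace (𝓘(ℝ, E).prod 𝓘(ℝ, F)) p from (L p w, w)) := by
  obtain ⟨w, rfl⟩ := hz
  exact ⟨w, rfl⟩

theorem finrank_graphBundle (p : M × Ω) :
    Module.finrank ℝ (graphBundle L p) = Module.finrank ℝ F :=
  LinearMap.finrank_range_of_inj (f := ((L p).prod
    (ContinuousLinearMap.id ℝ (TangentSpace 𝓘(ℝ, F) p.2))).toLinearMap)
    fun _ _ h => congrArg Prod.snd h

variable {S : ∀ p : M × Ω, Submodule ℝ (TangentSpace 𝓘(ℝ, E) p.1)}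

theorem mk_mem_prodZero {p : M × Ω} {v : TangentSpace 𝓘(ℝ, E) p.1} (hv : v ∈ S p) :
    (show TangentSpace (𝓘(ℝ, E).prod 𝓘(ℝ, F)) p from (v, 0)) ∈
      prodZero (I := 𝓘(ℝ, E)) (J := 𝓘(ℝ, F)) S p :=
  ⟨v, hv, rfl⟩

theorem exists_of_mem_prodZero {p : M × Ω} {z : TangentSpace (𝓘(ℝ, E).prod 𝓘(ℝ, F)) p}
    (hz : z ∈ prodZero (I := 𝓘(ℝ, E)) (J := 𝓘(ℝ, F)) S p) : ∃ v ∈ S p,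
      z = (show TangentSpace (𝓘(ℝ, E).prod 𝓘(ℝ, F)) p from (v, 0)) := by
  obtain ⟨v, hv, rfl⟩ := hz
  exact ⟨v, hv, rfl⟩

theorem isInternal_prodZero_graphBundle {U : ∀ p : M × Ω, Submodule ℝ (TangentSpace 𝓘(ℝ, E) p.1)}
    (p : M × Ω) (hSU : IsCompl (S p) (U p)) :
    DirectSum.IsInternal ![prodZero (I := 𝓘(ℝ, E)) (J := 𝓘(ℝ, F)) S p, graphBundle L p,
      prodZero (I := 𝓘(ℝ, E)) (J := 𝓘(ℝ, F)) U p] := by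
  have hadd : ∀ (v v' : TangentSpace 𝓘(ℝ, E) p.1) (w : TangentSpace 𝓘(ℝ, F) p.2),
      (show TangentSpace (𝓘(ℝ, E).prod 𝓘(ℝ, F)) p from (v, 0)) +
        (show TangentSpace (𝓘(ℝ, E).prod 𝓘(ℝ, F)) p from (L p w, w)) +
        (show TangentSpace (𝓘(ℝ, E).prod 𝓘(ℝ, F)) p from (v', 0)) =
      (show TangentSpace (𝓘(ℝ, E).prod 𝓘(ℝ, F)) p from (v + L p w + v', w)) :=
    fun v v' w => Prod.ext rfl ((add_zero ((0 : TangentSpace 𝓘(ℝ, F) p.2) + w)).trans (zero_add w))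
  refine isInternal_three (fun z => ?_) fun z₁ h₁ z₂ h₂ z₃ h₃ h => ?_
  · obtain ⟨x, w⟩ := z
    -- The graph vector is forced by the `Ω`-component `w`; the remainder `x - L w` splits along `S
    -- ⊕ U`.
    obtain ⟨v, hv, u, hu, h⟩ := Submodule.mem_sup.1
      (hSU.sup_eq_top ▸ Submodule.mem_top : (show TangentSpace 𝓘(ℝ, E) p.1 from x) - L p w ∈ S p ⊔ U p)
    refine ⟨_, mk_mem_prodZero hv, _, mk_mem_graphBundle p w, _, mk_mem_prodZero hu,
      (hadd v u w).trans (Prod.ext ?_ rfl)⟩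
    change v + L p w + u = x
    rw [add_right_comm, h]
    exact sub_add_cancel _ _
  · obtain ⟨v, hv, rfl⟩ := exists_of_mem_prodZero h₁
    obtain ⟨w, rfl⟩ := exists_of_mem_graphBundle h₂
    obtain ⟨u, hu, rfl⟩ := exists_of_mem_prodZero h₃
    have h' := (hadd v u w).symm.trans h
    have hw : w = 0 := congrArg Prod.snd h'
    have hvu : v + L p w + u = 0 := congrArg Prod.fst h'
    subst hw
    rw [map_zero, add_zero] at hvu
    have hv0 : v = 0 := Submodule.disjoint_def.1 hSU.disjoint v hv
      (eq_neg_of_add_eq_zero_left hvu ▸ (U p).neg_mem hu)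
    subst hv0
    rw [zero_add] at hvu
    subst hvu
    exact ⟨rfl, Prod.ext (map_zero (L p)) rfl, rfl⟩

variable [IsManifold 𝓘(ℝ, E) 1 M] [IsManifold 𝓘(ℝ, F) 1 Ω]

theorem isContinuousSubbundle_prodZero
    (hS : IsContinuousSubbundle E (fun x : M => TangentSpace 𝓘(ℝ, E) x) Prod.fst S) :
    IsContinuousSubbundle (E × F) (fun p : M × Ω => TangentSpace (𝓘(ℝ, E).prod 𝓘(ℝ, F)) p) id
      (prodZero (I := 𝓘(ℝ, E)) (J := 𝓘(ℝ, F)) S) := by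
  intro p₀
  obtain ⟨N, hN, hp₀, k, s, hs, hspan⟩ := hS p₀
  refine ⟨N, hN, hp₀, k, fun i p => (show TangentSpace (𝓘(ℝ, E).prod 𝓘(ℝ, F)) p from (s i p, 0)),
    fun i => ?_, fun p hp => ⟨?_, ?_⟩⟩
  · have h := (contMDiff_equivTangentBundleProd_symm (I := 𝓘(ℝ, E)) (M := M) (I' := 𝓘(ℝ, F))
      (M' := Ω) (n := 0)).continuous
    have h0 := (Bundle.Trivialization.continuous_zeroSection (B := Ω) (F := F) ℝ
      (E := TangentSpace 𝓘(ℝ, F))).comp (continuous_snd (X := M))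
    exact h.comp_continuousOn ((hs i).prodMk h0.continuousOn)
  · exact (hspan p hp).1.map' (ContinuousLinearMap.inl ℝ (TangentSpace 𝓘(ℝ, E) p.1)
      (TangentSpace 𝓘(ℝ, F) p.2)).toLinearMap
      (LinearMap.ker_eq_bot.2 fun _ _ h => congrArg Prod.fst h)
  · have h : prodZero (I := 𝓘(ℝ, E)) (J := 𝓘(ℝ, F)) S p = Submodule.span ℝ (_root_.Set.range
        (ContinuousLinearMap.inl ℝ (TangentSpace 𝓘(ℝ, E) p.1) (TangentSpace 𝓘(ℝ, F) p.2) ∘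
          fun i => s i p)) := by
      rw [prodZero, ← (hspan p hp).2]
      exact (Submodule.map_span _ _).trans (congrArg _ (_root_.Set.range_comp _ _).symm)
    exact h.symm

theorem isContinuousSubbundle_graphBundle [FiniteDimensional ℝ F]
    (hL : Continuous fun q : M × TangentBundle 𝓘(ℝ, F) Ω =>
      (⟨q.1, L (q.1, q.2.1) q.2.2⟩ : TangentBundle 𝓘(ℝ, E) M)) :
    IsContinuousSubbundle (E × F) (fun p : M × Ω => TangentSpace (𝓘(ℝ, E).prod 𝓘(ℝ, F)) p) id
      (graphBundle L) := by
  intro p₀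
  let e := trivializationAt F (TangentSpace 𝓘(ℝ, F)) p₀.2
  let β := Module.finBasis ℝ F
  -- A local frame of `TΩ`; lifting it to the graph gives the frame of the graph bundle.
  let w : Fin (Module.finrank ℝ F) → ∀ t : Ω, TangentSpace 𝓘(ℝ, F) t := fun i t => e.symm t (β i)
  have hw : ∀ i, ContinuousOn (fun t => (⟨t, w i t⟩ : TangentBundle 𝓘(ℝ, F) Ω)) e.baseSet :=
    fun i => e.continuousOn_symm.comp (continuousOn_id.prodMk continuousOn_const)
      fun t ht => ⟨ht, trivial⟩
  have hwE : ∀ t (ht : t ∈ e.baseSet) i, w i t = (e.continuousLinearEquivAt ℝ t ht).symm (β i) :=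
    fun _ _ _ => rfl
  refine ⟨Prod.snd ⁻¹' e.baseSet, e.open_baseSet.preimage continuous_snd,
    show p₀.2 ∈ e.baseSet from FiberBundle.mem_baseSet_trivializationAt' p₀.2, _, fun i p =>
      (show TangentSpace (𝓘(ℝ, E).prod 𝓘(ℝ, F)) p from (L p (w i p.2), w i p.2)),
    fun i => ?_, fun p hp => ?_⟩
  · have h := (contMDiff_equivTangentBundleProd_symm (I := 𝓘(ℝ, E)) (M := M) (I' := 𝓘(ℝ, F))
      (M' := Ω) (n := 0)).continuous
    have h1 : ContinuousOn (fun p : M × Ω => (⟨p.2, w i p.2⟩ : TangentBundle 𝓘(ℝ, F) Ω))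
      (Prod.snd ⁻¹' e.baseSet) := (hw i).comp continuousOn_snd fun _ h => h
    exact h.comp_continuousOn ((hL.comp_continuousOn (continuousOn_fst.prodMk h1)).prodMk h1)
  · let ε := e.continuousLinearEquivAt ℝ p.2 hp
    let ι : F →ₗ[ℝ] TangentSpace (𝓘(ℝ, E).prod 𝓘(ℝ, F)) p :=
      ((L p).prod (ContinuousLinearMap.id ℝ (TangentSpace 𝓘(ℝ, F) p.2))).toLinearMap.comp
        (ε.symm : F →L[ℝ] TangentSpace 𝓘(ℝ, F) p.2).toLinearMap
    have hι : Function.Injective ι := fun x y h => ε.symm.injective (congrArg Prod.snd h)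
    constructor
    · exact β.linearIndependent.map' ι (LinearMap.ker_eq_bot.2 hι)
    · have h1 : LinearMap.range ι = graphBundle L p :=
        LinearMap.range_comp_of_range_eq_top _ (LinearMap.range_eq_top.2 ε.symm.surjective)
      rw [← h1, LinearMap.range_eq_map, ← β.span_eq, Submodule.map_span, ← Set.range_comp]
      rfl

end Subbundles

/-! ### The invariant graph as a sum of its unstable and stable parts. -/

section InvariantSection

variable {E : Type*} [NormedAddCommGroup E] [NormedSpace ℝ E]
  {M : Type*} [TopologicalSpace M] [ChartedSpace E M]
  {F : Type*} [NormedAddCommGroup F] [NormedSpace ℝ F]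
  {Ω : Type*} [TopologicalSpace Ω] [ChartedSpace F Ω]
  {f : Ω → M ≃ₘ^2⟮𝓘(ℝ, E), 𝓘(ℝ, E)⟯ M} {θ : Ω ≃ₘ^1⟮𝓘(ℝ, F), 𝓘(ℝ, F)⟯ Ω}
  {S U : ∀ p : M × Ω, Submodule ℝ (TangentSpace 𝓘(ℝ, E) p.1)}

theorem projection_mfderiv (hSU : ∀ p, IsCompl (S p) (U p))
    (hS : ∀ p : M × Ω, (S p).map (mfderiv 𝓘(ℝ, E) 𝓘(ℝ, E) (f p.2) p.1).toLinearMap =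
      S (f p.2 p.1, θ p.2))
    (hU : ∀ p : M × Ω, (U p).map (mfderiv 𝓘(ℝ, E) 𝓘(ℝ, E) (f p.2) p.1).toLinearMap =
      U (f p.2 p.1, θ p.2)) (p : M × Ω) (v : TangentSpace 𝓘(ℝ, E) p.1) :
    (U (f p.2 p.1, θ p.2)).projection (S (f p.2 p.1, θ p.2)) (hSU (f p.2 p.1, θ p.2)).symm
      (mfderiv 𝓘(ℝ, E) 𝓘(ℝ, E) (f p.2) p.1 v) =
    mfderiv 𝓘(ℝ, E) 𝓘(ℝ, E) (f p.2) p.1 ((U p).projection (S p) (hSU p).symm v) := by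
  obtain ⟨s, hs, u, hu, rfl⟩ := Submodule.mem_sup.1
    ((hSU p).sup_eq_top ▸ Submodule.mem_top : v ∈ S p ⊔ U p)
  have hs' : mfderiv 𝓘(ℝ, E) 𝓘(ℝ, E) (f p.2) p.1 s ∈ S (f p.2 p.1, θ p.2) := by
    rw [← hS p]; exact ⟨s, hs, rfl⟩
  have hu' : mfderiv 𝓘(ℝ, E) 𝓘(ℝ, E) (f p.2) p.1 u ∈ U (f p.2 p.1, θ p.2) := by
    rw [← hU p]; exact ⟨u, hu, rfl⟩
  rw [map_add, map_add, map_add, (Submodule.projection_apply_eq_zero_iff _).2 hs',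
    (Submodule.projection_apply_eq_zero_iff _).2 hs, Submodule.projection_apply_of_mem_left _ hu',
    Submodule.projection_apply_of_mem_left _ hu, zero_add, zero_add]

/-- The tangent vectors `(v, w)` such that the `U`-component of `v` is `L w`. -/
def IsOverGraph (hSU : ∀ p, IsCompl (S p) (U p))
    (L : ∀ p : M × Ω, TangentSpace 𝓘(ℝ, F) p.2 →L[ℝ] TangentSpace 𝓘(ℝ, E) p.1)
    (ζ : TangentBundle (𝓘(ℝ, E).prod 𝓘(ℝ, F)) (M × Ω)) : Prop :=
  (U ζ.1).projection (S ζ.1) (hSU ζ.1).symm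
      (show TangentSpace 𝓘(ℝ, E) ζ.1.1 × TangentSpace 𝓘(ℝ, F) ζ.1.2 from ζ.2).1 =
    L ζ.1 (show TangentSpace 𝓘(ℝ, E) ζ.1.1 × TangentSpace 𝓘(ℝ, F) ζ.1.2 from ζ.2).2

/-- The `U`-component of `A v + B w` is `A (P_U v) + P_U B w`, and by `hL` the target value is `A (L
w) + P_U B w`. Injectivity of `A` gives both directions; the backward reading serves for the graph
obtained from the inverse map. -/
theorem isOverGraph_tangentMap_iff
    (hF : ContMDiff (𝓘(ℝ, E).prod 𝓘(ℝ, F)) 𝓘(ℝ, E) 1 fun p : M × Ω => f p.2 p.1)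
    (hSU : ∀ p, IsCompl (S p) (U p))
    (hS : ∀ p : M × Ω, (S p).map (mfderiv 𝓘(ℝ, E) 𝓘(ℝ, E) (f p.2) p.1).toLinearMap =
      S (f p.2 p.1, θ p.2))
    (hU : ∀ p : M × Ω, (U p).map (mfderiv 𝓘(ℝ, E) 𝓘(ℝ, E) (f p.2) p.1).toLinearMap =
      U (f p.2 p.1, θ p.2))
    {L : ∀ p : M × Ω, TangentSpace 𝓘(ℝ, F) p.2 →L[ℝ] TangentSpace 𝓘(ℝ, E) p.1}
    (hL : ∀ (p : M × Ω) (w : TangentSpace 𝓘(ℝ, F) p.2),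
        mfderiv 𝓘(ℝ, E) 𝓘(ℝ, E) (f p.2) p.1 (L p w) +
          (U (f p.2 p.1, θ p.2)).projection (S (f p.2 p.1, θ p.2)) (hSU (f p.2 p.1, θ p.2)).symm
            (mfderiv 𝓘(ℝ, F) 𝓘(ℝ, E) (fun t => f t p.1) p.2 w) =
        L (f p.2 p.1, θ p.2) (mfderiv 𝓘(ℝ, F) 𝓘(ℝ, F) θ p.2 w))
    (ζ : TangentBundle (𝓘(ℝ, E).prod 𝓘(ℝ, F)) (M × Ω)) :
    IsOverGraph hSU L (tangentMap (𝓘(ℝ, E).prod 𝓘(ℝ, F)) (𝓘(ℝ, E).prod 𝓘(ℝ, F))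
      (skewProduct f θ) ζ) ↔ IsOverGraph hSU L ζ := by
  obtain ⟨p, v, w⟩ := ζ
  have key : ∀ (v : TangentSpace 𝓘(ℝ, E) p.1) (w : TangentSpace 𝓘(ℝ, F) p.2),
      (U (f p.2 p.1, θ p.2)).projection (S (f p.2 p.1, θ p.2)) (hSU (f p.2 p.1, θ p.2)).symm
        (mfderiv 𝓘(ℝ, E) 𝓘(ℝ, E) (f p.2) p.1 v + mfderiv 𝓘(ℝ, F) 𝓘(ℝ, E) (fun t => f t p.1) p.2 w) =
        L (f p.2 p.1, θ p.2) (mfderiv 𝓘(ℝ, F) 𝓘(ℝ, F) θ p.2 w) ↔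
      (U p).projection (S p) (hSU p).symm v = L p w := by
    intro v w
    rw [map_add, projection_mfderiv hSU hS hU, ← hL, add_left_inj]
    exact (fiberDeriv (f p.2) p.1).injective.eq_iff
  have h1 : tangentMap (𝓘(ℝ, E).prod 𝓘(ℝ, F)) (𝓘(ℝ, E).prod 𝓘(ℝ, F))
      (skewProduct f θ) ⟨p, (v, w)⟩ = ⟨skewProduct f θ p, _⟩ :=
    congrArg (TotalSpace.mk (skewProduct f θ p)) (mfderiv_skewProduct_apply (θ := θ) hF p v w)
  rw [h1]
  exact key v w

variable [IsManifold 𝓘(ℝ, E) 1 M] [IsManifold 𝓘(ℝ, F) 1 Ω]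
  [FiniteDimensional ℝ E] [FiniteDimensional ℝ F] [CompactSpace M] [CompactSpace Ω]
  [T2Space M] [T2Space Ω]
  [RiemannianBundle (fun x : M => TangentSpace 𝓘(ℝ, E) x)]
  [IsContinuousRiemannianBundle E (fun x : M => TangentSpace 𝓘(ℝ, E) x)]
  [RiemannianBundle (fun t : Ω => TangentSpace 𝓘(ℝ, F) t)]
  [IsContinuousRiemannianBundle F (fun t : Ω => TangentSpace 𝓘(ℝ, F) t)]

/-- If the growth rates of `θ` lie strictly between those of the fibre maps on `S` and on `U`, then
the skew product leaves a continuous graph over `TΩ` invariant. -/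
theorem exists_invariant_section
    (hF : ContMDiff (𝓘(ℝ, E).prod 𝓘(ℝ, F)) 𝓘(ℝ, E) 1 fun p : M × Ω => f p.2 p.1)
    (hSc : IsContinuousSubbundle E (fun x : M => TangentSpace 𝓘(ℝ, E) x) Prod.fst S)
    (hUc : IsContinuousSubbundle E (fun x : M => TangentSpace 𝓘(ℝ, E) x) Prod.fst U)
    (hSU : ∀ p, IsCompl (S p) (U p))
    (hS : ∀ p : M × Ω, (S p).map (mfderiv 𝓘(ℝ, E) 𝓘(ℝ, E) (f p.2) p.1).toLinearMap =
      S (f p.2 p.1, θ p.2))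
    (hU : ∀ p : M × Ω, (U p).map (mfderiv 𝓘(ℝ, E) 𝓘(ℝ, E) (f p.2) p.1).toLinearMap =
      U (f p.2 p.1, θ p.2))
    {a b c d : ℝ} (ha : 0 < a) (hab : a < b) (hc : 0 < c) (hcd : c < d)
    (hfS : ∀ p : M × Ω, ∀ v ∈ S p, ‖mfderiv 𝓘(ℝ, E) 𝓘(ℝ, E) (f p.2) p.1 v‖ ≤ a * ‖v‖)
    (hθ' : ∀ (t : Ω) (w : TangentSpace 𝓘(ℝ, F) t),
      ‖mfderiv 𝓘(ℝ, F) 𝓘(ℝ, F) θ.symm t w‖ ≤ b⁻¹ * ‖w‖)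
    (hθ : ∀ (t : Ω) (w : TangentSpace 𝓘(ℝ, F) t), ‖mfderiv 𝓘(ℝ, F) 𝓘(ℝ, F) θ t w‖ ≤ c * ‖w‖)
    (hfU : ∀ p : M × Ω, ∀ v ∈ U p, d * ‖v‖ ≤ ‖mfderiv 𝓘(ℝ, E) 𝓘(ℝ, E) (f p.2) p.1 v‖) :
    ∃ L : ∀ p : M × Ω, TangentSpace 𝓘(ℝ, F) p.2 →L[ℝ] TangentSpace 𝓘(ℝ, E) p.1,
      (Continuous fun q : M × TangentBundle 𝓘(ℝ, F) Ω =>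
        (⟨q.1, L (q.1, q.2.1) q.2.2⟩ : TangentBundle 𝓘(ℝ, E) M)) ∧
      ∀ (p : M × Ω) (w : TangentSpace 𝓘(ℝ, F) p.2),
        mfderiv 𝓘(ℝ, E) 𝓘(ℝ, E) (f p.2) p.1 (L p w) +
          mfderiv 𝓘(ℝ, F) 𝓘(ℝ, E) (fun t => f t p.1) p.2 w =
        L (f p.2 p.1, θ p.2) (mfderiv 𝓘(ℝ, F) 𝓘(ℝ, F) θ p.2 w) := by
  have hF' := contMDiff_inverseFamily (θ := θ) hF
  have hF'' : ContMDiff (𝓘(ℝ, E).prod 𝓘(ℝ, F)) 𝓘(ℝ, E) 1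
      fun p : M × Ω => inverseFamily (inverseFamily f θ) θ.symm p.2 p.1 := by
    rw [inverseFamily_inverseFamily]
    exact hF
  obtain ⟨Lu, hLu, hLuc, hLui⟩ := exists_invariant_graph hF hF' hSc hUc hSU hU hc.le hcd hθ hfU
  -- For the inverse map `S` is expanded by at least `a⁻¹` while `θ.symm` expands by at most `b⁻¹ <
  -- a⁻¹`, so `S` takes the role of `U`.
  obtain ⟨Ls, hLs, hLsc, hLsi⟩ := exists_invariant_graph hF' hF'' hUc hSc (fun p => (hSU p).symm)
    (map_mfderiv_inverseFamily hS) (inv_nonneg.2 (ha.trans hab).le) (inv_strictAnti₀ ha hab) hθ'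
    (le_norm_mfderiv_inverseFamily hS ha hfS)
  have hQu := isOverGraph_tangentMap_iff hF hSU hS hU hLui
  have hQs := isOverGraph_tangentMap_iff hF' (fun p => (hSU p).symm)
    (map_mfderiv_inverseFamily hU) (map_mfderiv_inverseFamily hS) hLsi
  have hφ := contMDiff_skewProduct (θ := θ) hF
  have hφ' := contMDiff_skewProduct (θ := θ.symm) hF'
  have hcancel : ∀ ζ : TangentBundle (𝓘(ℝ, E).prod 𝓘(ℝ, F)) (M × Ω),
      tangentMap (𝓘(ℝ, E).prod 𝓘(ℝ, F)) (𝓘(ℝ, E).prod 𝓘(ℝ, F))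
        (skewProduct (inverseFamily f θ) θ.symm)
        (tangentMap (𝓘(ℝ, E).prod 𝓘(ℝ, F)) (𝓘(ℝ, E).prod 𝓘(ℝ, F)) (skewProduct f θ) ζ) = ζ := by
    intro ζ
    have h := tangentMap_comp_at (I := 𝓘(ℝ, E).prod 𝓘(ℝ, F)) (I' := 𝓘(ℝ, E).prod 𝓘(ℝ, F))
      (I'' := 𝓘(ℝ, E).prod 𝓘(ℝ, F)) (f := skewProduct f θ)
      (g := skewProduct (inverseFamily f θ) θ.symm) ζ (hφ'.mdifferentiable one_ne_zero _)
      (hφ.mdifferentiable one_ne_zero _)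
    rw [show (skewProduct (inverseFamily f θ) θ.symm ∘ skewProduct f θ : M × Ω → M × Ω) = id from
      funext (skewProduct f θ).symm_apply_apply, tangentMap_id] at h
    exact h.symm
  refine ⟨fun p => Lu p + Ls p, continuous_iff_continuousAt.2 fun q =>
    hLuc.continuousAt.add_section hLsc.continuousAt, fun p w => ?_⟩
  let ζ : TangentBundle (𝓘(ℝ, E).prod 𝓘(ℝ, F)) (M × Ω) := ⟨p, ((Lu p + Ls p) w, w)⟩
  have hζu : IsOverGraph hSU Lu ζ := by
    change (U p).projection (S p) (hSU p).symm (Lu p w + Ls p w) = Lu p w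
    rw [map_add, Submodule.projection_apply_of_mem_left _ (hLu p w),
      (Submodule.projection_apply_eq_zero_iff _).2 (hLs p w), add_zero]
  have hζs : IsOverGraph (fun p => (hSU p).symm) Ls ζ := by
    change (S p).projection (U p) (hSU p) (Lu p w + Ls p w) = Ls p w
    rw [map_add, Submodule.projection_apply_of_mem_left _ (hLs p w),
      (Submodule.projection_apply_eq_zero_iff _).2 (hLu p w), zero_add]
  have h1 : tangentMap (𝓘(ℝ, E).prod 𝓘(ℝ, F)) (𝓘(ℝ, E).prod 𝓘(ℝ, F))
      (skewProduct f θ) ζ = ⟨skewProduct f θ p, _⟩ :=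
    congrArg (TotalSpace.mk (skewProduct f θ p))
      (mfderiv_skewProduct_apply (θ := θ) hF p ((Lu p + Ls p) w) w)
  have h2 := (hQu ζ).2 hζu
  -- The inverse derivative sends `Dφ ζ` back to `ζ`, which lies over `Ls`; hence so does `Dφ ζ`.
  -- Adding its `U`- and `S`-components then gives the full identity.
  have h3 := (hQs (tangentMap (𝓘(ℝ, E).prod 𝓘(ℝ, F)) (𝓘(ℝ, E).prod 𝓘(ℝ, F))
    (skewProduct f θ) ζ)).1 (by rwa [hcancel])
  rw [h1] at h2 h3
  have h4 : ∀ z : TangentSpace 𝓘(ℝ, E) (f p.2 p.1),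
      (U (f p.2 p.1, θ p.2)).projection (S (f p.2 p.1, θ p.2)) (hSU (f p.2 p.1, θ p.2)).symm z +
      (S (f p.2 p.1, θ p.2)).projection (U (f p.2 p.1, θ p.2)) (hSU (f p.2 p.1, θ p.2)) z = z :=
    fun z => Submodule.projection_add_projection_eq_self _ z
  exact (h4 _).symm.trans (congrArg₂ (· + ·) h2 h3)

end InvariantSection

/-! ### Real rate constants and domination. -/

/-- Two finite numbers fit in the strict gap. The smaller lies strictly above the supremum, hence is
positive even when the supremum vanishes; the convention `0⁻¹ = ∞` covers `dim Ω = 0`. -/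
theorem exists_pos_lt_of_iSup_lt_iInf {α β : Type*} {u : α → ℝ≥0∞} {v : β → ℝ≥0∞}
    (h : ⨆ x, u x < ⨅ y, (v y)⁻¹) : ∃ a b : ℝ, 0 < a ∧ a < b ∧
      (∀ x, u x ≤ ENNReal.ofReal a) ∧ ∀ y, v y ≤ ENNReal.ofReal b⁻¹ := by
  obtain ⟨a, ha, ha'⟩ := ENNReal.lt_iff_exists_nnreal_btwn.1 h
  obtain ⟨b, hb, hb'⟩ := ENNReal.lt_iff_exists_nnreal_btwn.1 ha'
  have ha0 : 0 < a := ENNReal.coe_pos.1 (bot_le.trans_lt ha)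
  have hab : a < b := ENNReal.coe_lt_coe.1 hb
  refine ⟨a, b, ha0, hab, fun x => ?_, fun y => ?_⟩
  · rw [ENNReal.ofReal_coe_nnreal]
    exact (le_iSup u x).trans ha.le
  · rw [ENNReal.ofReal_inv_of_pos (NNReal.coe_pos.2 (ha0.trans hab)), ENNReal.ofReal_coe_nnreal]
    exact ENNReal.le_inv_iff_le_inv.1 (hb'.le.trans (iInf_le _ y))

theorem IsContMDiffRiemannianBundle.isContinuousRiemannianBundle
    {EB : Type*} [NormedAddCommGroup EB] [NormedSpace ℝ EB]
    {HB : Type*} [TopologicalSpace HB] (IB : ModelWithCorners ℝ EB HB) (n : ℕ∞ω)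
    {B : Type*} [TopologicalSpace B] [ChartedSpace HB B]
    (F : Type*) [NormedAddCommGroup F] [NormedSpace ℝ F]
    (V : B → Type*) [TopologicalSpace (TotalSpace F V)] [∀ x, NormedAddCommGroup (V x)]
    [∀ x, InnerProductSpace ℝ (V x)] [FiberBundle F V] [VectorBundle ℝ F V]
    [h : IsContMDiffRiemannianBundle IB n F V] : IsContinuousRiemannianBundle F V := by
  obtain ⟨g, hg, hgi⟩ := h.exists_contMDiff
  exact ⟨g, hg.continuous, hgi⟩

theorem ContinuousLinearMap.le_of_enorm_le {V W : Type*} [SeminormedAddCommGroup V]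
    [SeminormedAddCommGroup W] [NormedSpace ℝ V] [NormedSpace ℝ W] (A : V →L[ℝ] W) {r : ℝ}
    (hr : 0 ≤ r) (hA : ‖A‖ₑ ≤ ENNReal.ofReal r) (v : V) : ‖A v‖ ≤ r * ‖v‖ := by
  rw [← ofReal_norm, ENNReal.ofReal_le_ofReal_iff hr] at hA
  exact A.le_of_opNorm_le hA v

theorem isDominatedBy_of_rates {E : Type*} [NormedAddCommGroup E] [NormedSpace ℝ E]
    {H : Type*} [TopologicalSpace H] {I : ModelWithCorners ℝ E H}
    {N : Type*} [TopologicalSpace N] [ChartedSpace H N] [IsManifold I 1 N]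
    [RiemannianBundle (fun p : N => TangentSpace I p)] {φ : N → N}
    {T S : ∀ p : N, Submodule ℝ (TangentSpace I p)} {a b c c' : ℝ} (ha : 0 < a) (hab : a < b)
    (hc : 0 < c) (hc' : 0 < c')
    (hT : ∀ (n : ℕ) (p : N), ∀ u ∈ T p, ‖mfderiv I I (φ^[n]) p u‖ ≤ c * a ^ n * ‖u‖)
    (hS : ∀ (n : ℕ) (p : N), ∀ v ∈ S p, b ^ n * ‖v‖ ≤ c' * ‖mfderiv I I (φ^[n]) p v‖) :
    IsDominatedBy I φ T S := by
  have hb := ha.trans hab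
  refine ⟨c * c', mul_pos hc hc', a / b, div_pos ha hb, (div_lt_one hb).2 hab,
    fun n p u hu v hv => ?_⟩
  have hv' : ‖v‖ ≤ c' * ‖mfderiv I I (φ^[n]) p v‖ / b ^ n := by
    rw [le_div_iff₀ (pow_pos hb n), mul_comm]
    exact hS n p v hv
  refine (mul_le_mul (hT n p u hu) hv' (norm_nonneg _) (by positivity)).trans_eq ?_
  rw [div_pow]
  ring

/-! ### Action of the derivative on the three bundles. -/

section Derivative

variable {E : Type*} [NormedAddCommGroup E] [NormedSpace ℝ E]
  {M : Type*} [TopologicalSpace M] [ChartedSpace E M]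
  {F : Type*} [NormedAddCommGroup F] [NormedSpace ℝ F]
  {Ω : Type*} [TopologicalSpace Ω] [ChartedSpace F Ω]
  {f : Ω → M ≃ₘ^2⟮𝓘(ℝ, E), 𝓘(ℝ, E)⟯ M} {θ : Ω ≃ₘ^1⟮𝓘(ℝ, F), 𝓘(ℝ, F)⟯ Ω}
  {S : ∀ p : M × Ω, Submodule ℝ (TangentSpace 𝓘(ℝ, E) p.1)}
  {L : ∀ p : M × Ω, TangentSpace 𝓘(ℝ, F) p.2 →L[ℝ] TangentSpace 𝓘(ℝ, E) p.1}

/-- The component of a tangent vector along `Ω`. -/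
def horizontal (p : M × Ω) (z : TangentSpace (𝓘(ℝ, E).prod 𝓘(ℝ, F)) p) : TangentSpace 𝓘(ℝ, F) p.2 :=
  (show TangentSpace 𝓘(ℝ, E) p.1 × TangentSpace 𝓘(ℝ, F) p.2 from z).2

variable (hF : ContMDiff (𝓘(ℝ, E).prod 𝓘(ℝ, F)) 𝓘(ℝ, E) 1 fun p : M × Ω => f p.2 p.1)
include hF

theorem mfderiv_skewProduct_mk_zero (p : M × Ω) (v : TangentSpace 𝓘(ℝ, E) p.1) :
    mfderiv (𝓘(ℝ, E).prod 𝓘(ℝ, F)) (𝓘(ℝ, E).prod 𝓘(ℝ, F)) (skewProduct f θ) p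
      (show TangentSpace (𝓘(ℝ, E).prod 𝓘(ℝ, F)) p from (v, 0)) =
    (show TangentSpace (𝓘(ℝ, E).prod 𝓘(ℝ, F)) (skewProduct f θ p) from
      (mfderiv 𝓘(ℝ, E) 𝓘(ℝ, E) (f p.2) p.1 v, 0)) := by
  refine (mfderiv_skewProduct_apply hF p v 0).trans (Prod.ext ?_ (map_zero _))
  change _ + mfderiv 𝓘(ℝ, F) 𝓘(ℝ, E) (fun t => f t p.1) p.2 0 = _
  rw [map_zero, add_zero]

theorem horizontal_mfderiv_skewProduct (p : M × Ω)
    (z : TangentSpace (𝓘(ℝ, E).prod 𝓘(ℝ, F)) p) :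
    horizontal (skewProduct f θ p)
      (mfderiv (𝓘(ℝ, E).prod 𝓘(ℝ, F)) (𝓘(ℝ, E).prod 𝓘(ℝ, F)) (skewProduct f θ) p z) =
    mfderiv 𝓘(ℝ, F) 𝓘(ℝ, F) θ p.2 (horizontal p z) :=
  congrArg Prod.snd (mfderiv_skewProduct_apply (θ := θ) hF p _ _)

theorem map_mfderiv_prodZero
    (hS : ∀ p : M × Ω, (S p).map (mfderiv 𝓘(ℝ, E) 𝓘(ℝ, E) (f p.2) p.1).toLinearMap =
      S (skewProduct f θ p)) (p : M × Ω) :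
    (prodZero S p).map (mfderiv (𝓘(ℝ, E).prod 𝓘(ℝ, F)) (𝓘(ℝ, E).prod 𝓘(ℝ, F))
      (skewProduct f θ) p).toLinearMap = prodZero S (skewProduct f θ p) := by
  ext z
  constructor
  · rintro ⟨y, hy, rfl⟩
    obtain ⟨v, hv, rfl⟩ := exists_of_mem_prodZero hy
    have h : mfderiv 𝓘(ℝ, E) 𝓘(ℝ, E) (f p.2) p.1 v ∈ S (skewProduct f θ p) := hS p ▸ ⟨v, hv, rfl⟩
    exact (mfderiv_skewProduct_mk_zero hF p v).symm ▸ mk_mem_prodZero h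
  · intro hz
    obtain ⟨v, hv, rfl⟩ := exists_of_mem_prodZero hz
    rw [← hS p] at hv
    obtain ⟨u, hu, rfl⟩ := hv
    exact ⟨_, mk_mem_prodZero hu, mfderiv_skewProduct_mk_zero hF p u⟩

theorem map_mfderiv_graphBundle
    (hL : ∀ (p : M × Ω) (w : TangentSpace 𝓘(ℝ, F) p.2),
        mfderiv 𝓘(ℝ, E) 𝓘(ℝ, E) (f p.2) p.1 (L p w) +
          mfderiv 𝓘(ℝ, F) 𝓘(ℝ, E) (fun t => f t p.1) p.2 w =
        L (f p.2 p.1, θ p.2) (mfderiv 𝓘(ℝ, F) 𝓘(ℝ, F) θ p.2 w)) (p : M × Ω) :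
    (graphBundle L p).map (mfderiv (𝓘(ℝ, E).prod 𝓘(ℝ, F)) (𝓘(ℝ, E).prod 𝓘(ℝ, F))
      (skewProduct f θ) p).toLinearMap = graphBundle L (skewProduct f θ p) := by
  have h : ∀ w : TangentSpace 𝓘(ℝ, F) p.2,
      mfderiv (𝓘(ℝ, E).prod 𝓘(ℝ, F)) (𝓘(ℝ, E).prod 𝓘(ℝ, F)) (skewProduct f θ) p
        (show TangentSpace (𝓘(ℝ, E).prod 𝓘(ℝ, F)) p from (L p w, w)) =
      (show TangentSpace (𝓘(ℝ, E).prod 𝓘(ℝ, F)) (skewProduct f θ p) from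
        (L (skewProduct f θ p) (mfderiv 𝓘(ℝ, F) 𝓘(ℝ, F) θ p.2 w),
          mfderiv 𝓘(ℝ, F) 𝓘(ℝ, F) θ p.2 w)) :=
    fun w => (mfderiv_skewProduct_apply hF p (L p w) w).trans (Prod.ext (hL p w) rfl)
  ext z
  constructor
  · rintro ⟨y, hy, rfl⟩
    obtain ⟨w, rfl⟩ := exists_of_mem_graphBundle hy
    exact (h w).symm ▸ mk_mem_graphBundle _ _
  · intro hz
    obtain ⟨w, rfl⟩ := exists_of_mem_graphBundle hz
    obtain ⟨w, rfl⟩ := (θ.mfderivToContinuousLinearEquiv one_ne_zero p.2).surjective w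
    exact ⟨_, mk_mem_graphBundle p w, h w⟩

variable [RiemannianBundle (fun t : Ω => TangentSpace 𝓘(ℝ, F) t)]

theorem norm_horizontal_mfderiv_iterate_le {a : ℝ} (ha : 0 ≤ a)
    (hθ : ∀ (t : Ω) (w : TangentSpace 𝓘(ℝ, F) t), ‖mfderiv 𝓘(ℝ, F) 𝓘(ℝ, F) θ t w‖ ≤ a * ‖w‖)
    (n : ℕ) (p : M × Ω) (z : TangentSpace (𝓘(ℝ, E).prod 𝓘(ℝ, F)) p) :
    ‖horizontal _ (mfderiv (𝓘(ℝ, E).prod 𝓘(ℝ, F)) (𝓘(ℝ, E).prod 𝓘(ℝ, F))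
      ((skewProduct f θ)^[n]) p z)‖ ≤ a ^ n * ‖horizontal p z‖ := by
  refine (mfderiv_iterate_le (h := fun p z => ‖horizontal p z‖) (S := fun _ => ⊤)
    ((contMDiff_skewProduct (θ := θ) hF).mdifferentiable one_ne_zero) ha (fun _ _ _ => trivial)
    (fun p z _ => ?_) n p trivial).2
  rw [horizontal_mfderiv_skewProduct hF]
  exact hθ _ _

theorem le_norm_horizontal_mfderiv_iterate {a : ℝ} (ha : 0 ≤ a)
    (hθ : ∀ (t : Ω) (w : TangentSpace 𝓘(ℝ, F) t), a * ‖w‖ ≤ ‖mfderiv 𝓘(ℝ, F) 𝓘(ℝ, F) θ t w‖)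
    (n : ℕ) (p : M × Ω) (z : TangentSpace (𝓘(ℝ, E).prod 𝓘(ℝ, F)) p) :
    a ^ n * ‖horizontal p z‖ ≤ ‖horizontal _ (mfderiv (𝓘(ℝ, E).prod 𝓘(ℝ, F))
      (𝓘(ℝ, E).prod 𝓘(ℝ, F)) ((skewProduct f θ)^[n]) p z)‖ := by
  -- The sign change turns the iterated upper bound into a lower bound.
  have h := (mfderiv_iterate_le (h := fun p z => -‖horizontal p z‖) (S := fun _ => ⊤)
    ((contMDiff_skewProduct (θ := θ) hF).mdifferentiable one_ne_zero) ha (fun _ _ _ => trivial)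
    (fun p z _ => ?_) n p (v := z) trivial).2
  · rwa [mul_neg, neg_le_neg_iff] at h
  rw [mul_neg, neg_le_neg_iff, horizontal_mfderiv_skewProduct hF]
  exact hθ _ _

end Derivative

/-! ### Growth rates in the product metric. -/

section Rates

variable {E : Type*} [NormedAddCommGroup E] [NormedSpace ℝ E]
  {M : Type*} [TopologicalSpace M] [ChartedSpace E M]
  [RiemannianBundle (fun x : M => TangentSpace 𝓘(ℝ, E) x)]
  {F : Type*} [NormedAddCommGroup F] [NormedSpace ℝ F]
  {Ω : Type*} [TopologicalSpace Ω] [ChartedSpace F Ω]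
  [RiemannianBundle (fun t : Ω => TangentSpace 𝓘(ℝ, F) t)]
  {f : Ω → M ≃ₘ^2⟮𝓘(ℝ, E), 𝓘(ℝ, E)⟯ M} {θ : Ω ≃ₘ^1⟮𝓘(ℝ, F), 𝓘(ℝ, F)⟯ Ω}
  {S : ∀ p : M × Ω, Submodule ℝ (TangentSpace 𝓘(ℝ, E) p.1)}
  {L : ∀ p : M × Ω, TangentSpace 𝓘(ℝ, F) p.2 →L[ℝ] TangentSpace 𝓘(ℝ, E) p.1}

theorem norm_mk_zero (p : M × Ω) (v : TangentSpace 𝓘(ℝ, E) p.1) :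
    ‖(show TangentSpace (𝓘(ℝ, E).prod 𝓘(ℝ, F)) p from (v, 0))‖ = ‖v‖ := by
  have h := norm_sq_prod (I := 𝓘(ℝ, E)) (J := 𝓘(ℝ, F)) p v 0
  rw [norm_zero, zero_pow two_ne_zero, add_zero] at h
  exact (pow_left_inj₀ (norm_nonneg _) (norm_nonneg _) two_ne_zero).1 h

theorem norm_horizontal_le (p : M × Ω) (z : TangentSpace (𝓘(ℝ, E).prod 𝓘(ℝ, F)) p) :
    ‖horizontal p z‖ ≤ ‖z‖ := by
  obtain ⟨v, w⟩ := z
  have h := norm_sq_prod (I := 𝓘(ℝ, E)) (J := 𝓘(ℝ, F)) p v w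
  refine le_of_sq_le_sq ?_ (norm_nonneg _)
  exact (le_add_of_nonneg_left (sq_nonneg _)).trans h.ge

/-- From `K² + 1 ≤ (K + 1)²`. With `norm_horizontal_le`, it makes the growth on the graph that of
`θ` up to the factor `K + 1`. -/
theorem norm_le_of_mem_graphBundle {K : ℝ} (hK0 : 0 ≤ K) (hK : ∀ p, ‖L p‖ ≤ K) {p : M × Ω}
    {z : TangentSpace (𝓘(ℝ, E).prod 𝓘(ℝ, F)) p} (hz : z ∈ graphBundle L p) :
    ‖z‖ ≤ (K + 1) * ‖horizontal p z‖ := by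
  obtain ⟨w, rfl⟩ := exists_of_mem_graphBundle hz
  have h := norm_sq_prod (I := 𝓘(ℝ, E)) (J := 𝓘(ℝ, F)) p (L p w) w
  have hw : ‖L p w‖ ≤ K * ‖w‖ := (L p).le_of_opNorm_le (hK p) w
  refine le_of_sq_le_sq (h.le.trans ?_) (by positivity)
  change ‖L p w‖ ^ 2 + ‖w‖ ^ 2 ≤ ((K + 1) * ‖w‖) ^ 2
  have h1 := pow_le_pow_left₀ (norm_nonneg _) hw 2
  have h2 : 0 ≤ K * ‖w‖ ^ 2 := by positivity
  nlinarith

variable (hF : ContMDiff (𝓘(ℝ, E).prod 𝓘(ℝ, F)) 𝓘(ℝ, E) 1 fun p : M × Ω => f p.2 p.1)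
include hF

theorem norm_mfderiv_iterate_prodZero_le
    (hS : ∀ p : M × Ω, (S p).map (mfderiv 𝓘(ℝ, E) 𝓘(ℝ, E) (f p.2) p.1).toLinearMap =
      S (skewProduct f θ p)) {a : ℝ} (ha : 0 ≤ a)
    (hf : ∀ p : M × Ω, ∀ v ∈ S p, ‖mfderiv 𝓘(ℝ, E) 𝓘(ℝ, E) (f p.2) p.1 v‖ ≤ a * ‖v‖)
    (n : ℕ) (p : M × Ω) (z : TangentSpace (𝓘(ℝ, E).prod 𝓘(ℝ, F)) p) (hz : z ∈ prodZero S p) :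
    ‖mfderiv (𝓘(ℝ, E).prod 𝓘(ℝ, F)) (𝓘(ℝ, E).prod 𝓘(ℝ, F)) ((skewProduct f θ)^[n]) p z‖ ≤
      a ^ n * ‖z‖ := by
  refine (mfderiv_iterate_le (h := fun _ z => ‖z‖)
    ((contMDiff_skewProduct (θ := θ) hF).mdifferentiable one_ne_zero) ha
    (fun p z hz => map_mfderiv_prodZero hF hS p ▸ Submodule.mem_map_of_mem hz)
    (fun p z hz => ?_) n p hz).2
  obtain ⟨v, hv, rfl⟩ := exists_of_mem_prodZero hz
  have h := (congrArg norm (mfderiv_skewProduct_mk_zero (θ := θ) hF p v)).trans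
    (norm_mk_zero (skewProduct f θ p) _)
  rw [norm_mk_zero]
  exact h.trans_le (hf p v hv)

theorem le_norm_mfderiv_iterate_prodZero
    (hS : ∀ p : M × Ω, (S p).map (mfderiv 𝓘(ℝ, E) 𝓘(ℝ, E) (f p.2) p.1).toLinearMap =
      S (skewProduct f θ p)) {a : ℝ} (ha : 0 ≤ a)
    (hf : ∀ p : M × Ω, ∀ v ∈ S p, a * ‖v‖ ≤ ‖mfderiv 𝓘(ℝ, E) 𝓘(ℝ, E) (f p.2) p.1 v‖)
    (n : ℕ) (p : M × Ω) (z : TangentSpace (𝓘(ℝ, E).prod 𝓘(ℝ, F)) p) (hz : z ∈ prodZero S p) :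
    a ^ n * ‖z‖ ≤
      ‖mfderiv (𝓘(ℝ, E).prod 𝓘(ℝ, F)) (𝓘(ℝ, E).prod 𝓘(ℝ, F)) ((skewProduct f θ)^[n]) p z‖ := by
  have h := (mfderiv_iterate_le (h := fun _ z => -‖z‖)
    ((contMDiff_skewProduct (θ := θ) hF).mdifferentiable one_ne_zero) ha
    (fun p z hz => map_mfderiv_prodZero hF hS p ▸ Submodule.mem_map_of_mem hz)
    (fun p z hz => ?_) n p hz).2
  · rwa [mul_neg, neg_le_neg_iff] at h
  obtain ⟨v, hv, rfl⟩ := exists_of_mem_prodZero hz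
  have h := (congrArg norm (mfderiv_skewProduct_mk_zero (θ := θ) hF p v)).trans
    (norm_mk_zero (skewProduct f θ p) _)
  rw [mul_neg, neg_le_neg_iff, norm_mk_zero]
  exact (hf p v hv).trans_eq h.symm

end Rates

/-! ### Partial hyperbolicity. -/

section Main

variable {E : Type*} [NormedAddCommGroup E] [NormedSpace ℝ E] [FiniteDimensional ℝ E]
  {M : Type*} [TopologicalSpace M] [ChartedSpace E M] [IsManifold 𝓘(ℝ, E) 1 M]
  [T2Space M] [CompactSpace M]
  [RiemannianBundle (fun x : M => TangentSpace 𝓘(ℝ, E) x)]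
  [IsContinuousRiemannianBundle E (fun x : M => TangentSpace 𝓘(ℝ, E) x)]
  {F : Type*} [NormedAddCommGroup F] [NormedSpace ℝ F] [FiniteDimensional ℝ F]
  {Ω : Type*} [TopologicalSpace Ω] [ChartedSpace F Ω] [IsManifold 𝓘(ℝ, F) 1 Ω]
  [T2Space Ω] [CompactSpace Ω]
  [RiemannianBundle (fun t : Ω => TangentSpace 𝓘(ℝ, F) t)]
  [IsContinuousRiemannianBundle F (fun t : Ω => TangentSpace 𝓘(ℝ, F) t)]
  {f : Ω → M ≃ₘ^2⟮𝓘(ℝ, E), 𝓘(ℝ, E)⟯ M} {θ : Ω ≃ₘ^1⟮𝓘(ℝ, F), 𝓘(ℝ, F)⟯ Ω}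
  {Es Eu : ∀ p : M × Ω, Submodule ℝ (TangentSpace 𝓘(ℝ, E) p.1)} {lam : ℝ}

theorem isPartiallyHyperbolic_skewProduct
    (hF : ContMDiff (𝓘(ℝ, E).prod 𝓘(ℝ, F)) 𝓘(ℝ, E) 1 fun p : M × Ω => f p.2 p.1)
    (hA : IsAnosovOnFibers f θ Es Eu lam) {a b c d : ℝ} (ha : 0 < a) (hab : a < b) (hc : 0 < c)
    (hcd : c < d)
    (hfS : ∀ p : M × Ω, ∀ v ∈ Es p, ‖mfderiv 𝓘(ℝ, E) 𝓘(ℝ, E) (f p.2) p.1 v‖ ≤ a * ‖v‖)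
    (hθ' : ∀ (t : Ω) (w : TangentSpace 𝓘(ℝ, F) t),
      ‖mfderiv 𝓘(ℝ, F) 𝓘(ℝ, F) θ.symm t w‖ ≤ b⁻¹ * ‖w‖)
    (hθ : ∀ (t : Ω) (w : TangentSpace 𝓘(ℝ, F) t), ‖mfderiv 𝓘(ℝ, F) 𝓘(ℝ, F) θ t w‖ ≤ c * ‖w‖)
    (hfU : ∀ p : M × Ω, ∀ v ∈ Eu p, d * ‖v‖ ≤ ‖mfderiv 𝓘(ℝ, E) 𝓘(ℝ, E) (f p.2) p.1 v‖) :
    ∃ Ec : ∀ p : M × Ω, Submodule ℝ (TangentSpace (𝓘(ℝ, E).prod 𝓘(ℝ, F)) p),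
      IsPartiallyHyperbolic (𝓘(ℝ, E).prod 𝓘(ℝ, F)) (skewProduct f θ)
        (prodZero Es) Ec (prodZero Eu) ∧
      ∀ p, Module.finrank ℝ (Ec p) = Module.finrank ℝ F := by
  obtain ⟨L, hLc, hL⟩ := exists_invariant_section hF hA.continuous_stable hA.continuous_unstable
    hA.splitting hA.invariant_stable hA.invariant_unstable ha hab hc hcd hfS hθ' hθ hfU
  obtain ⟨K, hK⟩ := exists_opNorm_le_of_continuous L hLc
  have hK' : ∀ p, ‖L p‖ ≤ |K| := fun p => (hK p).trans (le_abs_self K)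
  have hb : 0 < b := ha.trans hab
  have hd : 0 < d := hc.trans hcd
  have hK1 : 0 < |K| + 1 := by positivity
  have hθb : ∀ (t : Ω) (w : TangentSpace 𝓘(ℝ, F) t),
      b * ‖w‖ ≤ ‖mfderiv 𝓘(ℝ, F) 𝓘(ℝ, F) θ t w‖ := by
    intro t w
    have h := hθ' (θ t) (mfderiv 𝓘(ℝ, F) 𝓘(ℝ, F) θ t w)
    have h2 := congrArg (fun ξ : TangentBundle 𝓘(ℝ, F) Ω => ‖ξ.2‖)
      (tangentMap_symm_tangentMap one_ne_zero θ ⟨t, w⟩)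
    rw [← le_inv_mul_iff₀ hb]
    exact h2.ge.trans h
  have hLi := map_mfderiv_graphBundle hF hL
  have hmem : ∀ (n : ℕ) (p : M × Ω) (z : TangentSpace (𝓘(ℝ, E).prod 𝓘(ℝ, F)) p),
      z ∈ graphBundle L p → mfderiv (𝓘(ℝ, E).prod 𝓘(ℝ, F)) (𝓘(ℝ, E).prod 𝓘(ℝ, F))
        ((skewProduct f θ)^[n]) p z ∈ graphBundle L ((skewProduct f θ)^[n] p) :=
    -- Only invariance under iterates is wanted here, so the functional is trivial.
    fun n p z hz => (mfderiv_iterate_le (h := fun _ _ => 0)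
      ((contMDiff_skewProduct (θ := θ) hF).mdifferentiable one_ne_zero) zero_le_one
      (fun p z hz => hLi p ▸ Submodule.mem_map_of_mem hz) (fun _ _ _ => by simp) n p hz).1
  have hexp : Real.exp (-lam) < 1 := by
    rw [Real.exp_lt_one_iff]
    exact neg_lt_zero.2 hA.pos
  refine ⟨graphBundle L, ?_, finrank_graphBundle⟩
  exact {
    contMDiff := contMDiff_skewProduct hF
    contMDiff_symm := contMDiff_skewProduct_symm hF
    splitting := fun p => isInternal_prodZero_graphBundle p (hA.splitting p)
    continuous₁ := isContinuousSubbundle_prodZero hA.continuous_stable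
    continuous₂ := isContinuousSubbundle_graphBundle hLc
    continuous₃ := isContinuousSubbundle_prodZero hA.continuous_unstable
    invariant₁ := map_mfderiv_prodZero hF hA.invariant_stable
    invariant₂ := hLi
    invariant₃ := map_mfderiv_prodZero hF hA.invariant_unstable
    dominated₁₂ := isDominatedBy_of_rates ha hab one_pos hK1
      (fun n p u hu => (norm_mfderiv_iterate_prodZero_le hF hA.invariant_stable ha.le hfS n p u
        hu).trans_eq (by rw [one_mul]))
      fun n p v hv => by
        have h1 := le_norm_horizontal_mfderiv_iterate hF hb.le hθb n p v
        have h2 := norm_horizontal_le ((skewProduct f θ)^[n] p) (mfderiv (𝓘(ℝ, E).prod 𝓘(ℝ, F))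
          (𝓘(ℝ, E).prod 𝓘(ℝ, F)) ((skewProduct f θ)^[n]) p v)
        refine (mul_le_mul_of_nonneg_left (norm_le_of_mem_graphBundle (abs_nonneg K) hK' hv)
          (pow_nonneg hb.le n)).trans ?_
        rw [mul_left_comm]
        exact mul_le_mul_of_nonneg_left (h1.trans h2) hK1.le
    dominated₂₃ := isDominatedBy_of_rates hc hcd hK1 one_pos
      (fun n p u hu => by
        refine (norm_le_of_mem_graphBundle (abs_nonneg K) hK' (hmem n p u hu)).trans ?_
        rw [mul_assoc]
        exact mul_le_mul_of_nonneg_left ((norm_horizontal_mfderiv_iterate_le hF hc.le hθ n p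
          u).trans (mul_le_mul_of_nonneg_left (norm_horizontal_le p u) (pow_nonneg hc.le n))) hK1.le)
      fun n p v hv => (le_norm_mfderiv_iterate_prodZero hF hA.invariant_unstable hd.le hfU n p v
        hv).trans_eq (one_mul _).symm
    -- The rate comes from fibre hyperbolicity, since `a` is only known to be below `b` and may
    -- exceed `1`; likewise `d` may be below `1` in the expansion.
    contracted := ⟨1, one_pos, Real.exp (-lam), Real.exp_pos _, hexp, fun n p v hv =>
      (norm_mfderiv_iterate_prodZero_le hF hA.invariant_stable (Real.exp_pos _).le hA.contraction
        n p v hv).trans_eq (by rw [one_mul])⟩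
    expanded := ⟨1, one_pos, Real.exp (-lam), Real.exp_pos _, hexp, fun n p v hv => by
      have h := le_norm_mfderiv_iterate_prodZero hF hA.invariant_unstable (Real.exp_pos _).le
        hA.expansion n p v hv
      rwa [one_mul, Real.exp_neg, inv_pow, le_inv_mul_iff₀ (pow_pos (Real.exp_pos _) n)]⟩ }

end Main

end

theorem mainTheorem5
    {E : Type*} [NormedAddCommGroup E] [NormedSpace ℝ E] [FiniteDimensional ℝ E]
    {M : Type*} [TopologicalSpace M] [ChartedSpace E M] [IsManifold 𝓘(ℝ, E) ∞ M]
    [T2Space M] [CompactSpace M] [ConnectedSpace M]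
    [RiemannianBundle (fun x : M => TangentSpace 𝓘(ℝ, E) x)]
    [IsContMDiffRiemannianBundle 𝓘(ℝ, E) ∞ E (fun x : M => TangentSpace 𝓘(ℝ, E) x)]
    {F : Type*} [NormedAddCommGroup F] [NormedSpace ℝ F] [FiniteDimensional ℝ F]
    {Ω : Type*} [TopologicalSpace Ω] [ChartedSpace F Ω] [IsManifold 𝓘(ℝ, F) ∞ Ω]
    [T2Space Ω] [CompactSpace Ω]
    [RiemannianBundle (fun t : Ω => TangentSpace 𝓘(ℝ, F) t)]
    [IsContMDiffRiemannianBundle 𝓘(ℝ, F) ∞ F (fun t : Ω => TangentSpace 𝓘(ℝ, F) t)]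
    (f : Ω → M ≃ₘ^2⟮𝓘(ℝ, E), 𝓘(ℝ, E)⟯ M) (hf : IsC2Continuous f)
    (θ : Ω ≃ₘ^1⟮𝓘(ℝ, F), 𝓘(ℝ, F)⟯ Ω)
    (Es Eu : ∀ p : M × Ω, Submodule ℝ (TangentSpace 𝓘(ℝ, E) p.1)) (lam : ℝ)
    (hA : IsAnosovOnFibers f θ Es Eu lam)
    (hb : IsC1InParameter (I := 𝓘(ℝ, E)) (J := 𝓘(ℝ, F)) fun (t : Ω) (x : M) => f t x)
    (hb' : IsC1InParameter (I := 𝓘(ℝ, E)) (J := 𝓘(ℝ, F)) fun (t : Ω) (x : M) => (f t).symm x)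
    (hs : ⨆ p : M × Ω, ‖(mfderiv 𝓘(ℝ, E) 𝓘(ℝ, E) (f p.2) p.1).comp (Es p).subtypeL‖ₑ <
      ⨅ t : Ω, ‖mfderiv 𝓘(ℝ, F) 𝓘(ℝ, F) θ.symm t‖ₑ⁻¹)
    (hu : ⨆ t : Ω, ‖mfderiv 𝓘(ℝ, F) 𝓘(ℝ, F) θ t‖ₑ <
      ⨅ p : M × Ω, ‖(mfderiv 𝓘(ℝ, E) 𝓘(ℝ, E) (f (θ.symm p.2)).symm p.1).comp
        (Eu p).subtypeL‖ₑ⁻¹) :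
    ∃ Ec : ∀ p : M × Ω, Submodule ℝ (TangentSpace (𝓘(ℝ, E).prod 𝓘(ℝ, F)) p),
      IsPartiallyHyperbolic (𝓘(ℝ, E).prod 𝓘(ℝ, F)) (skewProduct f θ)
        (prodZero Es) Ec (prodZero Eu) ∧
      ∀ p, Module.finrank ℝ (Ec p) = Module.finrank ℝ F := by
  have hF := hf.contMDiff_uncurry hb
  have := IsContMDiffRiemannianBundle.isContinuousRiemannianBundle 𝓘(ℝ, E) ∞ E
    (fun x : M => TangentSpace 𝓘(ℝ, E) x)
  have := IsContMDiffRiemannianBundle.isContinuousRiemannianBundle 𝓘(ℝ, F) ∞ F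
    (fun t : Ω => TangentSpace 𝓘(ℝ, F) t)
  obtain ⟨a, b, ha, hab, hfS, hθ'⟩ := exists_pos_lt_of_iSup_lt_iInf hs
  obtain ⟨c, d, hc, hcd, hθ, hfU⟩ := exists_pos_lt_of_iSup_lt_iInf hu
  have hb0 : 0 ≤ b⁻¹ := inv_nonneg.2 (ha.trans hab).le
  have hd0 : 0 < d⁻¹ := inv_pos.2 (hc.trans hcd)
  refine isPartiallyHyperbolic_skewProduct hF hA ha hab hc hcd
    (fun p v hv => ContinuousLinearMap.le_of_enorm_le _ ha.le (hfS p) ⟨v, hv⟩) (fun t => ContinuousLinearMap.le_of_enorm_le _ hb0 (hθ' t))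
    (fun t => ContinuousLinearMap.le_of_enorm_le _ hc.le (hθ t)) fun p v hv => ?_
  -- `hu` bounds the inverse fibre maps on `Eu` by `d⁻¹`. The inverse of the inverse family is `f`,
  -- so `f` expands `Eu` by at least `(d⁻¹)⁻¹ = d`.
  have h := le_norm_mfderiv_inverseFamily (map_mfderiv_inverseFamily hA.invariant_unstable) hd0
    (fun p v hv => ContinuousLinearMap.le_of_enorm_le _ hd0.le (hfU p) ⟨v, hv⟩) p v hv
  rwa [inv_inv, inverseFamily_inverseFamily] at h
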